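/- For a function $f$ on the unit circle $\partial\mathcal D_1$ put $c_m[f]=\oint_{\partial\mathcal D_1}\frac{f(z)}{z^{m+1}}\frac{dz}{2i\pi}$, $m\in\mathbb Z$; $\partial\mathcal D_\eta$ is the positively oriented circle of radius $\eta$ centred at $0$. Let $U$ be an open neighbourhood of $\partial\mathcal D_1$, let $f$ be holomorphic on $U$ and non-vanishing on $\partial\mathcal D_1$, and assume that $f$ has a holomorphic logarithm $\ln f$ on $U$. Define $$\alpha(z)=\exp\Big\{-\sum_{k\ge 0}c_k[\ln f]\,z^k\Big\}\ \ (|z|<1),\qquad \alpha(z)=\exp\Big\{\sum_{k\ge1}c_{-k}[\ln f]\,z^{-k}\Big\}\ \ (|z|>1).$$ Fix $n\ge 0$ and $1>\eta_z>\eta_s>0$. For $N\ge1$ call $(h,p)$ admissible if $h_1,\dots,h_n\in\{1,\dots,N\}$ and $p_1,\dots,p_n\in\mathbb Z\setminus\{1,\dots,N\}$ are pairwise distinct, and set $\ell_{h_k}=p_k$ for $k=1,\dots,n$ and $\ell_a=a$ for $a\in\{1,\dots,N\}\setminus\{h_1,\dots,h_n\}$. Let $M=M^{(N,h,p)}$ be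 the $n\times n$ matrix $$M_{ab}=-\mathbf 1_{\mathbb N}(p_a)\oint_{\partial\mathcal D_{\eta_z}}\frac{dz}{2i\pi}\oint_{\partial\mathcal D_{\eta_s}}\frac{ds}{2i\pi}\,\frac{\alpha(z)}{\alpha(s)}\,\frac{s^{N-p_a}z^{h_b-N-1}}{z-s} +\mathbf 1_{\mathbb N}(-p_a)\oint_{\partial\mathcal D_{\eta_z^{-1}}}\frac{dz}{2i\pi}\oint_{\partial\mathcal D_{\eta_s^{-1}}}\frac{ds}{2i\pi}\,\frac{\alpha(s)}{\alpha(z)}\,\frac{s^{-p_a}z^{h_b-1}}{z-s},$$ where $\mathbb N=\{0,1,2,\dots\}$. Below, $O(N^{-\infty})$ denotes a quantity bounded in modulus, for all large $N$ and all admissible $(h,p)$, by some $\rho(N)$ that does not depend on $(h,p)$ and satisfies $\rho(N)=O(N^{-K})$ for every $K$. Then, uniformly in all admissible $(h,p)$ (which may vary with $N$ in any way): (i) $\displaystyle \det_N[c_{\ell_a-b}[f]]=\det_N[c_{a-b}[f]]\cdot\big(\det_n[M]+O(N^{-\infty})\big);$ (ii) for all $c>0$ and $L\in\mathbb N$, as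 long as $M$ is non-singular in the quantitative sense that $|\det_n[M]|\ge c\,N^{-L}$, $$\det_N[c_{\ell_a-b}[f]]=\det_N[c_{a-b}[f]]\cdot\det_n[M]\cdot\big(1+O(N^{-\infty})\big),$$ where $\rho$ may depend on $c$ and $L$. In particular (ii) applies with $L=0$ whenever $|\det_n[M]|$ stays bounded away from $0$, e.g. when $h$ and $p$ do not depend on $N$ and $M$ (which is then independent of $N$ for large $N$) is non-singular. -/

import Mathlib

open Filter Asymptotics

noncomputable section

namespace LacunaryToeplitz

/-- The Laurent coefficient `c_n[f] = (2 i π)⁻¹ ∮ f(z) z^{-n-1} dz` over the unit circle. -/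
def coeff (f : ℂ → ℂ) (n : ℤ) : ℂ :=
  (2 * Real.pi * Complex.I)⁻¹ * ∮ z in C(0, 1), f z / z ^ (n + 1)

/-- `h_1, …, h_n ∈ {1, …, N}` and `p_1, …, p_n ∈ ℤ \ {1, …, N}`, pairwise distinct. -/
structure Admissible (N : ℕ) {n : ℕ} (h p : Fin n → ℤ) : Prop where
  h_mem : ∀ k, h k ∈ Set.Icc (1 : ℤ) N
  p_notMem : ∀ k, p k ∉ Set.Icc (1 : ℤ) N
  h_inj : Function.Injective h
  p_inj : Function.Injective p

/-- The lacunary sequence: `ℓ_{h_k} = p_k`, and `ℓ_a = a` if `a` is none of the `h_k`. -/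
def ell {n : ℕ} (h p : Fin n → ℤ) : ℤ → ℤ :=
  Function.extend h p id

/-- The `N × N` matrix with entries `c_{a-b}[f]`, `1 ≤ a, b ≤ N`. -/
def toeplitz (f : ℂ → ℂ) (N : ℕ) : Matrix (Fin N) (Fin N) ℂ :=
  Matrix.of fun a b => coeff f (((a : ℤ) + 1) - ((b : ℤ) + 1))

/-- The `N × N` matrix with entries `c_{ℓ_a-b}[f]`, `1 ≤ a, b ≤ N`. -/
def lacunaryToeplitz (f : ℂ → ℂ) (N : ℕ) {n : ℕ} (h p : Fin n → ℤ) :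
    Matrix (Fin N) (Fin N) ℂ :=
  Matrix.of fun a b => coeff f (ell h p ((a : ℤ) + 1) - ((b : ℤ) + 1))

/-- The piecewise analytic Wiener–Hopf factor built from `g = ln f`. It is only ever used off the
unit circle; the value that the second branch gives on the circle itself is irrelevant. -/
def alpha (g : ℂ → ℂ) (z : ℂ) : ℂ :=
  if ‖z‖ < 1 then Complex.exp (-∑' k : ℕ, coeff g (k : ℤ) * z ^ k)
  else Complex.exp (∑' k : ℕ, coeff g (-((k : ℤ) + 1)) * z ^ (-((k : ℤ) + 1)))

/-- The `n × n` matrix `M` of double contour integrals; the indicator of `ℕ = {0, 1, 2, …}` at `p`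
(respectively `-p`) is the condition `0 ≤ p` (respectively `0 ≤ -p`). -/
def M (g : ℂ → ℂ) (ηz ηs : ℝ) (N : ℕ) {n : ℕ} (h p : Fin n → ℤ) : Matrix (Fin n) (Fin n) ℂ :=
  Matrix.of fun a b =>
    -(if 0 ≤ p a then
        (2 * Real.pi * Complex.I)⁻¹ * ∮ z in C(0, ηz),
          (2 * Real.pi * Complex.I)⁻¹ * ∮ s in C(0, ηs),
            alpha g z / alpha g s * (s ^ ((N : ℤ) - p a) * z ^ (h b - N - 1) / (z - s))
      else 0)
    + (if 0 ≤ -p a then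
        (2 * Real.pi * Complex.I)⁻¹ * ∮ z in C(0, ηz⁻¹),
          (2 * Real.pi * Complex.I)⁻¹ * ∮ s in C(0, ηs⁻¹),
            alpha g s / alpha g z * (s ^ (-p a) * z ^ (h b - 1) / (z - s))
      else 0)

/-- `ρ(N) = O(N^{-∞})`: `ρ(N) = O(N^{-K})` for every `K`. -/
def RapidlyDecaying (ρ : ℕ → ℝ) : Prop :=
  ∀ K : ℕ, ρ =O[atTop] fun N : ℕ => ((N : ℝ) ^ K)⁻¹

end LacunaryToeplitz

end

/-! Write f(z) = φ(z) ψ(1/z) on the unit circle, where φ and ψ are exponentials of the two halves of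
the Laurent series of ln f, holomorphic and zero-free in a disc of radius R > 1. Inside the circle α
= 1/φ, and α(1/z) = ψ(z).

Let row a be (c_{a-b}[f])_{1≤b≤N}, for any integer a. Since f/φ = ψ(1/z) has no positive Laurent
coefficients, convolving the coefficients of 1/φ with the rows up to m > N gives zero in the columns
b ≤ N; discarding the rows below 1 costs O(q^m). For m = N+1, …, p this is a triangular system for
the rows N+1, …, p, and the coefficients of φ invert it. So a row p > N is, up to O(q^N) uniformly
in p, a combination of rows 1, …, N with the explicit weights `weight` (`exists_row_bound`). Rows p
≤ 0 follow by the reflection z ↦ 1/z, a ↦ N+1-a, which exchanges φ and ψ. Expanding the Cauchy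
kernel shows that the entries of M are exactly these weights (`M_apply`).

The same factorization gives an approximate inverse of the Toeplitz matrix T with bounded entries
(`exists_approx_inverse`). It turns approximate row relations into exact ones: for large N, row p
equals yT with y within O(N q^N) of the weights (`exists_row_solution`). Replacing rows of T by
combinations of its rows multiplies det T by an n × n minor of the coefficients
(`det_eq_det_mul_of_rows`). This minor is a perturbation of det M of size O(N q^N), because the
weights are bounded independently of N, h and p. Part (ii) is part (i) divided by det M, since a
power of N does not spoil exponential decay. -/

namespace LacunaryToeplitz

/-! ### Laurent coefficients on circles -/

/-- The Laurent coefficient computed on the circle of radius `ρ`. -/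
noncomputable def circleCoeff (ρ : ℝ) (F : ℂ → ℂ) (n : ℤ) : ℂ :=
  (2 * Real.pi * Complex.I)⁻¹ * ∮ z in C(0, ρ), F z / z ^ (n + 1)

theorem coeff_eq_circleCoeff (F : ℂ → ℂ) (n : ℤ) : coeff F n = circleCoeff 1 F n := rfl

theorem circleCoeff_congr {ρ : ℝ} (hρ : 0 ≤ ρ) {F G : ℂ → ℂ}
    (h : Set.EqOn F G (Metric.sphere 0 ρ)) (n : ℤ) : circleCoeff ρ F n = circleCoeff ρ G n := by
  unfold circleCoeff
  congr 1
  refine circleIntegral.integral_congr hρ fun z hz => ?_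
  simp only [h hz]

theorem ne_zero_of_mem_sphere_zero {ρ : ℝ} (hρ : 0 < ρ) {z : ℂ} (hz : z ∈ Metric.sphere (0 : ℂ) ρ) :
    z ≠ 0 := by
  rintro rfl
  simp at hz
  exact hρ.ne hz

theorem circleIntegrable_div_zpow {ρ : ℝ} (hρ : 0 < ρ) {F : ℂ → ℂ}
    (hF : ContinuousOn F (Metric.sphere 0 ρ)) (n : ℤ) :
    CircleIntegrable (fun z => F z / z ^ n) 0 ρ := by
  refine ContinuousOn.circleIntegrable hρ.le (hF.div ?_ ?_)
  · exact fun z hz => (continuousAt_zpow₀ z n (.inl (ne_zero_of_mem_sphere_zero hρ hz))).continuousWithinAt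
  · exact fun z hz => zpow_ne_zero _ (ne_zero_of_mem_sphere_zero hρ hz)

theorem circleCoeff_add {ρ : ℝ} (hρ : 0 < ρ) {F G : ℂ → ℂ}
    (hF : ContinuousOn F (Metric.sphere 0 ρ)) (hG : ContinuousOn G (Metric.sphere 0 ρ)) (n : ℤ) :
    circleCoeff ρ (fun z => F z + G z) n = circleCoeff ρ F n + circleCoeff ρ G n := by
  unfold circleCoeff
  rw [← mul_add, ← circleIntegral.integral_add (circleIntegrable_div_zpow hρ hF _)
    (circleIntegrable_div_zpow hρ hG _)]
  simp only [add_div]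

theorem circleCoeff_sum {ρ : ℝ} (hρ : 0 < ρ) {ι : Type*} (s : Finset ι) {F : ι → ℂ → ℂ}
    (hF : ∀ i ∈ s, ContinuousOn (F i) (Metric.sphere 0 ρ)) (n : ℤ) :
    circleCoeff ρ (fun z => ∑ i ∈ s, F i z) n = ∑ i ∈ s, circleCoeff ρ (F i) n := by
  unfold circleCoeff
  rw [← Finset.mul_sum, ← circleIntegral.integral_fun_sum
    fun i hi => circleIntegrable_div_zpow hρ (hF i hi) _]
  simp only [Finset.sum_div]

theorem circleCoeff_const_mul (ρ : ℝ) (a : ℂ) (F : ℂ → ℂ) (n : ℤ) :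
    circleCoeff ρ (fun z => a * F z) n = a * circleCoeff ρ F n := by
  unfold circleCoeff
  simp only [mul_div_assoc, circleIntegral.integral_const_mul]
  ring

theorem circleCoeff_zpow_mul {ρ : ℝ} (hρ : 0 < ρ) (k : ℤ) (F : ℂ → ℂ) (n : ℤ) :
    circleCoeff ρ (fun z => z ^ k * F z) n = circleCoeff ρ F (n - k) := by
  unfold circleCoeff
  congr 1
  refine circleIntegral.integral_congr hρ.le fun z hz => ?_
  have hz0 := ne_zero_of_mem_sphere_zero hρ hz
  have : z ^ (n + 1) = z ^ (n - k + 1) * z ^ k := by rw [← zpow_add₀ hz0]; congr 1; ring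
  simp only [this]
  field_simp

theorem norm_circleCoeff_le {ρ : ℝ} (hρ : 0 < ρ) {F : ℂ → ℂ} {B : ℝ}
    (hB : ∀ z ∈ Metric.sphere (0 : ℂ) ρ, ‖F z‖ ≤ B) (n : ℤ) :
    ‖circleCoeff ρ F n‖ ≤ B * (ρ ^ n)⁻¹ := by
  have := circleIntegral.norm_two_pi_i_inv_smul_integral_le_of_norm_le_const
    (f := fun z => F z / z ^ (n + 1)) (C := B / ρ ^ (n + 1)) hρ.le fun z hz => by
      rw [norm_div, norm_zpow, mem_sphere_zero_iff_norm.1 hz]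
      gcongr
      exact hB z hz
  rw [smul_eq_mul] at this
  refine this.trans_eq ?_
  rw [zpow_add_one₀ hρ.ne']
  field_simp

theorem norm_coeff_le {F : ℂ → ℂ} {B : ℝ}
    (hB : ∀ z ∈ Metric.sphere (0 : ℂ) 1, ‖F z‖ ≤ B) (n : ℤ) : ‖coeff F n‖ ≤ B := by
  simpa [coeff_eq_circleCoeff] using norm_circleCoeff_le one_pos hB n

theorem circleCoeff_eq_of_annulus {r ρ : ℝ} (hr : 0 < r) (hρ : r ≤ ρ) {F : ℂ → ℂ}
    (hF : ∀ z : ℂ, r ≤ ‖z‖ → ‖z‖ ≤ ρ → DifferentiableAt ℂ F z) (n : ℤ) :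
    circleCoeff ρ F n = circleCoeff r F n := by
  unfold circleCoeff
  have key : ∀ z : ℂ, r ≤ ‖z‖ → ‖z‖ ≤ ρ → DifferentiableAt ℂ (fun z => F z / z ^ (n + 1)) z := by
    intro z h1 h2
    have hz : z ≠ 0 := norm_pos_iff.1 (hr.trans_le h1)
    exact (hF z h1 h2).div (differentiableAt_zpow.2 (.inl hz)) (zpow_ne_zero _ hz)
  congr 1
  refine Complex.circleIntegral_eq_of_differentiable_on_annulus_off_countable hr hρ
    Set.countable_empty ?_ ?_
  · rintro z ⟨h1, h2⟩
    simp only [mem_closedBall_zero_iff, mem_ball_zero_iff, not_lt] at h1 h2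
    exact (key z h2 h1).continuousAt.continuousWithinAt
  · rintro z ⟨⟨h1, h2⟩, -⟩
    simp only [mem_closedBall_zero_iff, mem_ball_zero_iff, not_le] at h1 h2
    exact key z h2.le h1.le

theorem circleCoeff_eq_coeff {R r : ℝ} (hR : 1 < R) (hr : 0 < r) (hrR : r < R) {F : ℂ → ℂ}
    (hF : DifferentiableOn ℂ F (Metric.ball 0 R)) (n : ℤ) :
    circleCoeff r F n = coeff F n := by
  have hd : ∀ z : ℂ, ‖z‖ < R → DifferentiableAt ℂ F z := fun z hz =>
    hF.differentiableAt (Metric.isOpen_ball.mem_nhds (mem_ball_zero_iff.2 hz))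
  rw [coeff_eq_circleCoeff]
  rcases le_total r 1 with h | h
  · exact (circleCoeff_eq_of_annulus hr h (fun z _ hz => hd z (hz.trans_lt hR)) n).symm
  · exact circleCoeff_eq_of_annulus one_pos h (fun z _ hz => hd z (hz.trans_lt hrR)) n

theorem circleCoeff_eq_zero_of_neg {R r : ℝ} (hr : 0 < r) (hrR : r < R) {F : ℂ → ℂ}
    (hF : DifferentiableOn ℂ F (Metric.ball 0 R)) {n : ℤ} (hn : n < 0) :
    circleCoeff r F n = 0 := by
  unfold circleCoeff
  obtain ⟨k, hk⟩ : ∃ k : ℕ, n + 1 = -(k : ℤ) := ⟨(-(n + 1)).toNat, by omega⟩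
  have key : ∀ z ∈ Metric.closedBall (0 : ℂ) r,
      DifferentiableAt ℂ (fun z => F z / z ^ (n + 1)) z := by
    intro z hz
    simp only [hk, zpow_neg, div_inv_eq_mul, zpow_natCast]
    exact (hF.differentiableAt (Metric.isOpen_ball.mem_nhds (mem_ball_zero_iff.2
      ((mem_closedBall_zero_iff.1 hz).trans_lt hrR)))).mul (differentiableAt_pow k)
  rw [Complex.circleIntegral_eq_zero_of_differentiable_on_off_countable hr.le Set.countable_empty
    (fun z hz => (key z hz).continuousAt.continuousWithinAt)
    (fun z hz => key z (Metric.ball_subset_closedBall hz.1)), mul_zero]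

theorem coeff_eq_zero_of_neg {R : ℝ} (hR : 1 < R) {F : ℂ → ℂ}
    (hF : DifferentiableOn ℂ F (Metric.ball 0 R)) {n : ℤ} (hn : n < 0) : coeff F n = 0 :=
  circleCoeff_eq_zero_of_neg one_pos hR hF hn

theorem coeff_one (n : ℤ) : coeff (fun _ => 1) n = if n = 0 then 1 else 0 := by
  have h : (∮ z in C(0, 1), (1 : ℂ) / z ^ (n + 1)) = ∮ z in C(0, 1), (z - 0) ^ (-(n + 1)) := by
    simp only [one_div, sub_zero, zpow_neg]
  unfold coeff
  split_ifs with hn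
  · subst hn
    have := circleIntegral.integral_sub_center_inv (0 : ℂ) (one_ne_zero (α := ℝ))
    simp only [sub_zero] at this
    simp only [zero_add, zpow_one, one_div, this]
    exact inv_mul_cancel₀ Complex.two_pi_I_ne_zero
  · rw [h, circleIntegral.integral_sub_zpow_of_ne (by omega), mul_zero]

/-! ### Taylor tails, convolutions and the inversion z ↦ 1/z -/

theorem cauchyPowerSeries_eq_circleCoeff {ρ : ℝ} (hρ : 0 < ρ) (F : ℂ → ℂ) (k : ℕ) (w : ℂ) :
    (cauchyPowerSeries F 0 ρ k fun _ => w) = circleCoeff ρ F k * w ^ k := by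
  rw [cauchyPowerSeries_apply F 0 ρ k w, circleCoeff, smul_eq_mul, mul_comm _ (w ^ k),
    mul_left_comm (w ^ k), ← circleIntegral.integral_const_mul (w ^ k)]
  congr 1
  refine circleIntegral.integral_congr hρ.le fun z hz => ?_
  have hz0 := ne_zero_of_mem_sphere_zero hρ hz
  have : z ^ ((k : ℤ) + 1) = z ^ k * z := by rw [zpow_add_one₀ hz0, zpow_natCast]
  simp only [this, sub_zero, smul_eq_mul, div_pow]
  field_simp

/-- Geometric decay of the Taylor remainders and of the Taylor coefficients on the unit circle. -/
theorem exists_taylor_bound {R : ℝ} (hR : 1 < R) {F : ℂ → ℂ}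
    (hF : DifferentiableOn ℂ F (Metric.ball 0 R)) :
    ∃ C q : ℝ, 0 ≤ C ∧ 0 < q ∧ q < 1 ∧
      (∀ J : ℕ, ∀ z ∈ Metric.sphere (0 : ℂ) 1,
        ‖F z - ∑ j ∈ Finset.range J, coeff F j * z ^ j‖ ≤ C * q ^ J) ∧
      ∀ j : ℕ, ‖coeff F j‖ ≤ C * q ^ j := by
  obtain ⟨r, h1r, hrR⟩ := exists_between hR
  obtain ⟨r', h1r', hrr'⟩ := exists_between h1r
  lift r to NNReal using by linarith
  lift r' to NNReal using by linarith
  have hr0 : (0 : ℝ) < r := by linarith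
  have hps := (hF.mono (Metric.closedBall_subset_ball hrR)).hasFPowerSeriesOnBall
    (NNReal.coe_pos.1 hr0)
  obtain ⟨a, ha, C, hC, h⟩ := hps.uniform_geometric_approx' (r' := r') (by exact_mod_cast hrr')
  have hr'0 : (0 : ℝ) < r' := by linarith
  have hrem : ∀ J : ℕ, ∀ z ∈ Metric.sphere (0 : ℂ) 1,
      ‖F z - ∑ j ∈ Finset.range J, coeff F j * z ^ j‖ ≤ C * (a / r') ^ J := by
    intro J z hz
    rw [mem_sphere_zero_iff_norm] at hz
    have := h z (by rw [mem_ball_zero_iff, hz]; exact h1r') J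
    rw [hz, zero_add, mul_one_div] at this
    refine le_trans (le_of_eq ?_) this
    congr 2
    refine Finset.sum_congr rfl fun j _ => ?_
    rw [cauchyPowerSeries_eq_circleCoeff hr0, circleCoeff_eq_coeff hR hr0 hrR hF]
  have hq1 : a / r' < 1 := by
    rw [div_lt_one hr'0]; exact ha.2.trans h1r'
  have hq0 : 0 < a / (r' : ℝ) := div_pos ha.1 hr'0
  refine ⟨2 * C, a / r', by positivity, hq0, hq1, ?_, ?_⟩
  · intro J z hz
    refine (hrem J z hz).trans ?_
    gcongr
    linarith
  · intro j
    -- A coefficient is the difference of two consecutive remainders at z = 1, hence the factor 2 in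
    -- the constant.
    have e : coeff F j = (F 1 - ∑ j ∈ Finset.range j, coeff F j * 1 ^ j) -
        (F 1 - ∑ j ∈ Finset.range (j + 1), coeff F j * 1 ^ j) := by
      simp [Finset.sum_range_succ]
    rw [e]
    have i1 := hrem j 1 (by simp)
    have i2 := hrem (j + 1) 1 (by simp)
    have i3 : (a / r') ^ (j + 1) ≤ (a / (r' : ℝ)) ^ j :=
      pow_le_pow_of_le_one hq0.le hq1.le (by omega)
    have i4 := mul_le_mul_of_nonneg_left i3 hC.le
    refine (norm_sub_le _ _).trans ?_
    linarith

theorem summable_norm_coeff {R : ℝ} (hR : 1 < R) {F : ℂ → ℂ}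
    (hF : DifferentiableOn ℂ F (Metric.ball 0 R)) : Summable fun k : ℤ => ‖coeff F k‖ := by
  obtain ⟨C, q, -, hq0, hq1, -, h⟩ := exists_taylor_bound hR hF
  refine Summable.of_nat_of_neg_add_one ?_ ?_
  · exact Summable.of_nonneg_of_le (fun _ => norm_nonneg _) h
      ((summable_geometric_of_lt_one hq0.le hq1).mul_left C)
  · refine summable_zero.congr fun n => ?_
    rw [coeff_eq_zero_of_neg hR hF (by omega), norm_zero]

/-- The Laurent coefficients of a product are, up to a geometrically small error, truncated
convolutions. -/
theorem exists_norm_sum_coeff_mul_sub_le {R : ℝ} (hR : 1 < R) {F G : ℂ → ℂ}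
    (hF : DifferentiableOn ℂ F (Metric.ball 0 R))
    (hG : ContinuousOn G (Metric.sphere 0 1)) :
    ∃ C q : ℝ, 0 ≤ C ∧ 0 < q ∧ q < 1 ∧ ∀ J : ℕ, ∀ k : ℤ,
      ‖∑ j ∈ Finset.range J, coeff F j * coeff G (k - j) - coeff (fun z => F z * G z) k‖
        ≤ C * q ^ J := by
  obtain ⟨C, q, hC, hq0, hq1, hrem, -⟩ := exists_taylor_bound hR hF
  obtain ⟨B, hB⟩ := (isCompact_sphere (0 : ℂ) 1).exists_bound_of_continuousOn hG
  have hB0 : 0 ≤ B := (norm_nonneg _).trans (hB 1 (by simp))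
  have hFc : ContinuousOn F (Metric.sphere 0 1) := hF.continuousOn.mono fun z hz => by
    rw [mem_ball_zero_iff, mem_sphere_zero_iff_norm.1 hz]; exact hR
  refine ⟨C * B, q, by positivity, hq0, hq1, fun J k => ?_⟩
  have e : coeff (fun z => F z * G z) k = ∑ j ∈ Finset.range J, coeff F j * coeff G (k - j) +
      coeff (fun z => (F z - ∑ j ∈ Finset.range J, coeff F j * z ^ j) * G z) k := by
    have hterm : ∀ j ∈ Finset.range J,
        ContinuousOn (fun z => coeff F j * (z ^ (j : ℤ) * G z)) (Metric.sphere 0 1) := by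
      intro j _
      simp only [zpow_natCast]
      exact continuousOn_const.mul ((continuousOn_pow j).mul hG)
    have e1 : ∑ j ∈ Finset.range J, coeff F j * coeff G (k - j) =
        circleCoeff 1 (fun z => ∑ j ∈ Finset.range J, coeff F j * (z ^ (j : ℤ) * G z)) k := by
      rw [circleCoeff_sum one_pos _ hterm]
      refine Finset.sum_congr rfl fun j _ => ?_
      rw [circleCoeff_const_mul, circleCoeff_zpow_mul one_pos, coeff_eq_circleCoeff G]
    rw [e1, coeff_eq_circleCoeff, coeff_eq_circleCoeff, ← circleCoeff_add one_pos]
    · refine circleCoeff_congr zero_le_one (fun z _ => ?_) k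
      simp only [sub_mul, Finset.sum_mul, zpow_natCast, ← mul_assoc]
      ring
    · exact continuousOn_finsetSum _ hterm
    · refine (hFc.sub (continuousOn_finsetSum _ fun j _ => ?_)).mul hG
      exact continuousOn_const.mul (continuousOn_pow j)
  rw [e, sub_add_cancel_left, norm_neg]
  refine norm_coeff_le (fun z hz => ?_) k
  rw [norm_mul, mul_right_comm]
  exact mul_le_mul (hrem J z hz) (hB z hz) (norm_nonneg _) (by positivity)

theorem circleIntegral_inv_radius {ρ : ℝ} (hρ : 0 < ρ) (F : ℂ → ℂ) :
    (∮ z in C(0, ρ⁻¹), F z) = ∮ z in C(0, ρ), F z⁻¹ * (z ^ 2)⁻¹ := by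
  have hinv : ∀ θ : ℝ, circleMap 0 ρ⁻¹ (-θ) = (circleMap 0 ρ θ)⁻¹ := by
    intro θ
    rw [circleMap_zero, circleMap_zero, mul_inv, ← Complex.exp_neg]
    push_cast
    rw [neg_mul]
  have hper : Function.Periodic
      (fun θ => deriv (circleMap 0 ρ⁻¹) θ • F (circleMap 0 ρ⁻¹ θ)) (2 * Real.pi) := by
    intro θ
    simp only [deriv_circleMap, periodic_circleMap 0 _ θ]
  unfold circleIntegral
  calc _ = ∫ θ in (-(2 * Real.pi))..(-(2 * Real.pi)) + 2 * Real.pi,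
        deriv (circleMap 0 ρ⁻¹) θ • F (circleMap 0 ρ⁻¹ θ) := by
          rw [hper.intervalIntegral_add_eq (-(2 * Real.pi)) 0, zero_add]
    _ = ∫ θ in (0 : ℝ)..2 * Real.pi, deriv (circleMap 0 ρ⁻¹) (-θ) • F (circleMap 0 ρ⁻¹ (-θ)) := by
          rw [intervalIntegral.integral_comp_neg
            (fun θ => deriv (circleMap 0 ρ⁻¹) θ • F (circleMap 0 ρ⁻¹ θ))]
          simp
    _ = _ := by
          refine intervalIntegral.integral_congr fun θ _ => ?_
          have h0 : circleMap 0 ρ θ ≠ 0 := circleMap_ne_center hρ.ne'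
          simp only [deriv_circleMap, hinv, smul_eq_mul]
          field_simp

theorem coeff_comp_inv (F : ℂ → ℂ) (n : ℤ) : coeff (fun z => F z⁻¹) n = coeff F (-n) := by
  unfold coeff
  have h := circleIntegral_inv_radius one_pos fun z => F z / z ^ (-n + 1)
  rw [inv_one] at h
  rw [h]
  congr 1
  refine circleIntegral.integral_congr zero_le_one fun z hz => ?_
  have hz0 := ne_zero_of_mem_sphere_zero one_pos hz
  have : z⁻¹ ^ (-n + 1) * z ^ 2 = z ^ (n + 1) := by
    rw [← zpow_natCast, inv_zpow', ← zpow_add₀ hz0]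
    congr 1
    push_cast
    ring
  simp only [← this]
  field_simp

/-! ### Wiener–Hopf factorization and approximate row relations -/

/-- A factorization `f(z) = φ(z) ψ(1/z)` on the unit circle, with factors that are holomorphic and
non-vanishing in a disc of radius greater than one. -/
structure IsWienerHopf (R : ℝ) (φ ψ f : ℂ → ℂ) : Prop where
  one_lt : 1 < R
  diff_left : DifferentiableOn ℂ φ (Metric.ball 0 R)
  diff_right : DifferentiableOn ℂ ψ (Metric.ball 0 R)
  left_ne_zero : ∀ z ∈ Metric.ball (0 : ℂ) R, φ z ≠ 0
  right_ne_zero : ∀ z ∈ Metric.ball (0 : ℂ) R, ψ z ≠ 0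
  eq_mul : ∀ z ∈ Metric.sphere (0 : ℂ) 1, f z = φ z * ψ z⁻¹

namespace IsWienerHopf

variable {R : ℝ} {φ ψ f : ℂ → ℂ}

theorem inv_mem_sphere {z : ℂ} (hz : z ∈ Metric.sphere (0 : ℂ) 1) :
    z⁻¹ ∈ Metric.sphere (0 : ℂ) 1 := by
  rw [mem_sphere_zero_iff_norm] at *
  rw [norm_inv, hz, inv_one]

/-- The symmetry that spares a second proof for rows p ≤ 0 and for the upper half of the approximate
inverse. -/
theorem reflect (w : IsWienerHopf R φ ψ f) : IsWienerHopf R ψ φ fun z => f z⁻¹ where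
  one_lt := w.one_lt
  diff_left := w.diff_right
  diff_right := w.diff_left
  left_ne_zero := w.right_ne_zero
  right_ne_zero := w.left_ne_zero
  eq_mul z hz := by rw [w.eq_mul _ (inv_mem_sphere hz), inv_inv, mul_comm]

theorem sphere_subset (w : IsWienerHopf R φ ψ f) :
    Metric.sphere (0 : ℂ) 1 ⊆ Metric.ball 0 R := fun z hz => by
  rw [mem_ball_zero_iff, mem_sphere_zero_iff_norm.1 hz]; exact w.one_lt

theorem diff_inv_left (w : IsWienerHopf R φ ψ f) :
    DifferentiableOn ℂ (fun z => (φ z)⁻¹) (Metric.ball 0 R) :=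
  w.diff_left.inv w.left_ne_zero

theorem continuousOn (w : IsWienerHopf R φ ψ f) : ContinuousOn f (Metric.sphere 0 1) := by
  refine ContinuousOn.congr ?_ w.eq_mul
  refine (w.diff_left.continuousOn.mono w.sphere_subset).mul
    ((w.diff_right.continuousOn.mono w.sphere_subset).comp ?_ fun z hz => inv_mem_sphere hz)
  exact continuousOn_inv₀.mono fun z hz => ne_zero_of_mem_sphere_zero one_pos hz

/-- The Taylor coefficients of `φ` and `1/φ` are inverse to each other under convolution. -/
theorem sum_coeff_mul_coeff_inv (w : IsWienerHopf R φ ψ f) {p h : ℤ} {s : Finset ℤ}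
    (hs : Finset.Icc h p ⊆ s) :
    ∑ m ∈ s, coeff φ (p - m) * coeff (fun z => (φ z)⁻¹) (m - h) = if p = h then 1 else 0 := by
  have hx {k : ℤ} (hk : k < 0) : coeff φ k = 0 := coeff_eq_zero_of_neg w.one_lt w.diff_left hk
  have hy {k : ℤ} (hk : k < 0) : coeff (fun z => (φ z)⁻¹) k = 0 :=
    coeff_eq_zero_of_neg w.one_lt w.diff_inv_left hk
  rw [← Finset.sum_subset hs]
  swap
  · intro m _ hm
    rw [Finset.mem_Icc, not_and_or, not_le, not_le] at hm
    rcases hm with hm | hm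
    · rw [hy (by omega), mul_zero]
    · rw [hx (by omega), zero_mul]
  rcases lt_or_ge p h with hph | hph
  · rw [Finset.Icc_eq_empty (by omega), if_neg (by omega), Finset.sum_empty]
  obtain ⟨C, q, -, hq0, hq1, hb⟩ := exists_norm_sum_coeff_mul_sub_le w.one_lt w.diff_left
    (w.diff_inv_left.continuousOn.mono w.sphere_subset)
  have h1 : coeff (fun z => φ z * (φ z)⁻¹) (p - h) = if p = h then 1 else 0 := by
    have := circleCoeff_congr (F := fun z => φ z * (φ z)⁻¹) (G := fun _ => 1) zero_le_one
      (fun z hz => mul_inv_cancel₀ (w.left_ne_zero z (w.sphere_subset hz))) (p - h)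
    rw [coeff_eq_circleCoeff, this, ← coeff_eq_circleCoeff, coeff_one]
    simp only [sub_eq_zero]
  -- The truncated convolution no longer changes once J > p - h, while its error tends to 0 as J
  -- grows; so the error is zero.
  rw [← h1, ← sub_eq_zero, ← norm_eq_zero]
  refine le_antisymm ?_ (norm_nonneg _)
  have ht : Tendsto (fun J : ℕ => C * q ^ J) atTop (nhds 0) := by
    simpa using (tendsto_pow_atTop_nhds_zero_of_lt_one hq0.le hq1).const_mul C
  refine ge_of_tendsto ht ?_
  filter_upwards [eventually_ge_atTop ((p - h).toNat + 1)] with J hJ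
  refine le_trans (le_of_eq ?_) (hb J (p - h))
  congr 2
  rw [← Finset.sum_subset (Finset.range_mono hJ)]
  · refine Finset.sum_nbij' (fun m => (p - m).toNat) (fun j => p - j) ?_ ?_ ?_ ?_ ?_
    · intro m hm; simp only [Finset.mem_Icc, Finset.mem_range] at *; omega
    · intro j hj; simp only [Finset.mem_Icc, Finset.mem_range] at *; omega
    · intro m hm; simp only [Finset.mem_Icc] at *; omega
    · intro j hj; simp
    · intro m hm
      simp only [Finset.mem_Icc] at hm
      rw [Int.toNat_of_nonneg (by omega)]
      congr 2
      ring
  · intro j _ hj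
    rw [Finset.mem_range, not_lt] at hj
    rw [hy (by omega), mul_zero]

/-- Convolving the coefficients of `1/φ` with those of `f` gives those of `ψ(1/z)`, up to a
geometrically small truncation error. -/
theorem exists_norm_sum_coeff_inv_mul_sub_le (w : IsWienerHopf R φ ψ f) :
    ∃ C q : ℝ, 0 ≤ C ∧ 0 < q ∧ q < 1 ∧ ∀ m b : ℤ, 0 ≤ m →
      ‖∑ h ∈ Finset.Icc 1 m, coeff (fun z => (φ z)⁻¹) (m - h) * coeff f (h - b) -
        coeff ψ (b - m)‖ ≤ C * q ^ m.toNat := by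
  obtain ⟨C, q, hC, hq0, hq1, hb⟩ := exists_norm_sum_coeff_mul_sub_le w.one_lt w.diff_inv_left
    w.continuousOn
  refine ⟨C, q, hC, hq0, hq1, fun m b hm => ?_⟩
  refine le_trans (le_of_eq ?_) (hb m.toNat (m - b))
  congr 2
  · refine Finset.sum_nbij' (fun h => (m - h).toNat) (fun j => m - j) ?_ ?_ ?_ ?_ ?_
    · intro m hm; simp only [Finset.mem_Icc, Finset.mem_range] at *; omega
    · intro j hj; simp only [Finset.mem_Icc, Finset.mem_range] at *; omega
    · intro m hm; simp only [Finset.mem_Icc] at *; omega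
    · intro j hj; simp
    · intro h hh
      simp only [Finset.mem_Icc] at hh
      rw [Int.toNat_of_nonneg (by omega)]
      congr 2
      ring
  · rw [← neg_sub m b, ← coeff_comp_inv]
    refine circleCoeff_congr zero_le_one (fun z hz => ?_) _
    have := w.left_ne_zero z (w.sphere_subset hz)
    simp only [w.eq_mul z hz]
    field_simp

theorem exists_sum_norm_coeff_le (w : IsWienerHopf R φ ψ f) :
    ∃ S : ℝ, 0 ≤ S ∧ ∀ (s : Finset ℤ) (p : ℤ), ∑ m ∈ s, ‖coeff φ (p - m)‖ ≤ S := by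
  have hs := summable_norm_coeff w.one_lt w.diff_left
  refine ⟨∑' k, ‖coeff φ k‖, tsum_nonneg fun _ => norm_nonneg _, fun s p => ?_⟩
  rw [← (Equiv.subLeft p).tsum_eq]
  exact ((Equiv.subLeft p).summable_iff.2 hs).sum_le_tsum s fun _ _ => norm_nonneg _

theorem exists_sum_norm_coeff_inv_le (w : IsWienerHopf R φ ψ f) :
    ∃ S : ℝ, 0 ≤ S ∧ ∀ (s : Finset ℤ) (d : ℤ),
      ∑ m ∈ s, ‖coeff (fun z => (φ z)⁻¹) (m - d)‖ ≤ S := by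
  have hs := summable_norm_coeff w.one_lt w.diff_inv_left
  refine ⟨∑' k, ‖coeff (fun z => (φ z)⁻¹) k‖, tsum_nonneg fun _ => norm_nonneg _, fun s d => ?_⟩
  rw [← (Equiv.subRight d).tsum_eq]
  exact ((Equiv.subRight d).summable_iff.2 hs).sum_le_tsum s fun _ _ => norm_nonneg _

theorem exists_norm_coeff_inv_le (w : IsWienerHopf R φ ψ f) :
    ∃ B : ℝ, 0 ≤ B ∧ ∀ k : ℤ, ‖coeff (fun z => (φ z)⁻¹) k‖ ≤ B := by
  obtain ⟨B, hB⟩ := (isCompact_sphere (0 : ℂ) 1).exists_bound_of_continuousOn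
    (w.diff_inv_left.continuousOn.mono w.sphere_subset)
  exact ⟨B, (norm_nonneg _).trans (hB 1 (by simp)), norm_coeff_le hB⟩

theorem sum_mul_sum_coeff_inv (x : ℤ → ℂ) (N : ℤ) (s : Finset ℤ) (b : ℤ) :
    ∑ h ∈ Finset.Icc 1 N, (∑ m ∈ s, x m * coeff (fun z => (φ z)⁻¹) (m - h)) * coeff f (h - b) =
      ∑ m ∈ s, x m * ∑ h ∈ Finset.Icc 1 N, coeff (fun z => (φ z)⁻¹) (m - h) * coeff f (h - b) := by
  simp only [Finset.sum_mul, Finset.mul_sum, mul_assoc]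
  exact Finset.sum_comm

theorem norm_sum_coeff_mul_le {S B : ℝ} {s : Finset ℤ} {x y : ℤ → ℂ} (hx : ∑ m ∈ s, ‖x m‖ ≤ S)
    (hB : 0 ≤ B) (hy : ∀ m ∈ s, ‖y m‖ ≤ B) : ‖∑ m ∈ s, x m * y m‖ ≤ S * B := by
  refine (norm_sum_le _ _).trans ?_
  refine le_trans ?_ (mul_le_mul_of_nonneg_right hx hB)
  rw [Finset.sum_mul]
  refine Finset.sum_le_sum fun m hm => ?_
  rw [norm_mul]
  exact mul_le_mul_of_nonneg_left (hy m hm) (norm_nonneg _)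

/-- The weights that express row `p > N` of the Toeplitz matrix through rows `1, …, N`. -/
noncomputable def weight (φ : ℂ → ℂ) (N p h : ℤ) : ℂ :=
  -∑ m ∈ Finset.Icc (N + 1) p, coeff φ (p - m) * coeff (fun z => (φ z)⁻¹) (m - h)

/-- For m > N ≥ b the coefficient of ψ(1/z) at m - b vanishes, so each such m gives an approximate
linear relation among rows 1, …, m. Combining these with the weights φ_{p-m} isolates row p.
Absolute summability of the coefficients of φ keeps the bounds uniform in p. -/
theorem exists_row_bound (w : IsWienerHopf R φ ψ f) :
    ∃ C q : ℝ, 0 ≤ C ∧ 0 < q ∧ q < 1 ∧ ∀ (N : ℕ) (p : ℤ), (N : ℤ) + 1 ≤ p →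
      (∀ h, ‖weight φ N p h‖ ≤ C) ∧
      ∀ b ∈ Finset.Icc (1 : ℤ) N,
        ‖coeff f (p - b) - ∑ h ∈ Finset.Icc (1 : ℤ) N, weight φ N p h * coeff f (h - b)‖
          ≤ C * q ^ N := by
  obtain ⟨C, q, hC, hq0, hq1, hrem⟩ := w.exists_norm_sum_coeff_inv_mul_sub_le
  obtain ⟨S, hS0, hS⟩ := w.exists_sum_norm_coeff_le
  obtain ⟨B, hB0, hB⟩ := w.exists_norm_coeff_inv_le
  refine ⟨S * B + S * C, q, by positivity, hq0, hq1, fun N p hp => ⟨fun h => ?_, fun b hb => ?_⟩⟩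
  · rw [weight, norm_neg]
    refine (norm_sum_coeff_mul_le (hS _ p) hB0 fun m _ => hB _).trans ?_
    linarith [mul_nonneg hS0 hC]
  rw [Finset.mem_Icc] at hb
  set a : ℤ → ℂ := coeff fun z => (φ z)⁻¹ with ha
  have ha0 {k : ℤ} (hk : k < 0) : a k = 0 := coeff_eq_zero_of_neg w.one_lt w.diff_inv_left hk
  have hsplit : ∀ m ∈ Finset.Icc ((N : ℤ) + 1) p,
      ∑ h ∈ Finset.Icc 1 m, a (m - h) * coeff f (h - b) =
        ∑ h ∈ Finset.Icc (1 : ℤ) N, a (m - h) * coeff f (h - b) +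
        ∑ h ∈ Finset.Icc ((N : ℤ) + 1) p, a (m - h) * coeff f (h - b) := by
    intro m hm
    rw [Finset.mem_Icc] at hm
    rw [← Finset.sum_union]
    · refine Finset.sum_subset (fun h => ?_) fun h _ hh => ?_
      · simp only [Finset.mem_union, Finset.mem_Icc]; omega
      · rw [ha0, zero_mul]
        simp_all only [Finset.mem_union, Finset.mem_Icc]; omega
    · rw [Finset.disjoint_left]
      intro h; simp only [Finset.mem_Icc]; omega
  -- The coefficients of φ and 1/φ cancel on the block N+1, …, p, leaving row p alone.
  have hconv : ∑ m ∈ Finset.Icc ((N : ℤ) + 1) p, coeff φ (p - m) *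
      ∑ h ∈ Finset.Icc ((N : ℤ) + 1) p, a (m - h) * coeff f (h - b) = coeff f (p - b) := by
    simp only [Finset.mul_sum, ← mul_assoc]
    rw [Finset.sum_comm]
    simp only [← Finset.sum_mul]
    rw [Finset.sum_eq_single p]
    · rw [w.sum_coeff_mul_coeff_inv, if_pos rfl, one_mul]
      exact Finset.Icc_subset_Icc hp le_rfl
    · intro h hh hne
      rw [w.sum_coeff_mul_coeff_inv, if_neg hne.symm, zero_mul]
      exact Finset.Icc_subset_Icc (Finset.mem_Icc.1 hh).1 le_rfl
    · intro h; exact absurd (Finset.mem_Icc.2 ⟨hp, le_rfl⟩) h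
  have e : coeff f (p - b) - ∑ h ∈ Finset.Icc (1 : ℤ) N, weight φ N p h * coeff f (h - b) =
      ∑ m ∈ Finset.Icc ((N : ℤ) + 1) p, coeff φ (p - m) *
        (∑ h ∈ Finset.Icc 1 m, a (m - h) * coeff f (h - b) - coeff ψ (b - m)) := by
    simp only [weight, neg_mul, Finset.sum_neg_distrib, sub_neg_eq_add]
    rw [sum_mul_sum_coeff_inv (fun m => coeff φ (p - m)), ← hconv, ← Finset.sum_add_distrib]
    refine Finset.sum_congr rfl fun m hm => ?_
    rw [hsplit m hm, coeff_eq_zero_of_neg w.one_lt w.diff_right, sub_zero, ← mul_add, add_comm]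
    rw [Finset.mem_Icc] at hm
    omega
  rw [e]
  refine (norm_sum_coeff_mul_le (B := C * q ^ N) (hS _ p) (by positivity) fun m hm => ?_).trans ?_
  · rw [Finset.mem_Icc] at hm
    refine (hrem m b (by omega)).trans ?_
    gcongr ?_ * ?_
    exact pow_le_pow_of_le_one hq0.le hq1.le (by omega)
  · rw [← mul_assoc]
    gcongr
    linarith [mul_nonneg hS0 hB0]

/-- Row d of the approximate inverse is ∑ (1/ψ)_{m-d} (1/φ)_{m-h} over d ≤ m ≤ N. Convolution with
1/φ turns f into ψ(1/z), and 1/ψ then turns this into the identity. -/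
theorem exists_inverse_row_bound (w : IsWienerHopf R φ ψ f) :
    ∃ C q : ℝ, 0 ≤ C ∧ 0 < q ∧ q < 1 ∧ ∀ (N : ℕ) (d : ℤ), (N : ℤ) + 1 ≤ 2 * d →
      ∃ x : ℤ → ℂ, (∀ h, ‖x h‖ ≤ C) ∧
      ∀ b ∈ Finset.Icc (1 : ℤ) N,
        ‖∑ h ∈ Finset.Icc (1 : ℤ) N, x h * coeff f (h - b) - if d = b then 1 else 0‖
          ≤ C * q ^ N := by
  obtain ⟨C, q, hC, hq0, hq1, hrem⟩ := w.exists_norm_sum_coeff_inv_mul_sub_le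
  obtain ⟨S, hS0, hS⟩ := w.reflect.exists_sum_norm_coeff_inv_le
  obtain ⟨B, hB0, hB⟩ := w.exists_norm_coeff_inv_le
  -- The truncation error is of order q^m with m ≥ d ≥ (N+1)/2, hence the rate √q; smaller d are
  -- reached by reflection.
  have hr1 : √q < 1 := by rw [← Real.sqrt_one]; exact Real.sqrt_lt_sqrt hq0.le hq1
  refine ⟨S * B + S * C, √q, by positivity, Real.sqrt_pos.2 hq0, hr1, fun N d hd =>
    ⟨fun h => ∑ m ∈ Finset.Icc d N,
      coeff (fun z => (ψ z)⁻¹) (m - d) * coeff (fun z => (φ z)⁻¹) (m - h),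
      fun h => ?_, fun b hb => ?_⟩⟩
  · refine (norm_sum_coeff_mul_le (hS _ d) hB0 fun m _ => hB _).trans ?_
    linarith [mul_nonneg hS0 hC]
  rw [Finset.mem_Icc] at hb
  have e : ∑ h ∈ Finset.Icc (1 : ℤ) N, (∑ m ∈ Finset.Icc d (N : ℤ),
        coeff (fun z => (ψ z)⁻¹) (m - d) * coeff (fun z => (φ z)⁻¹) (m - h)) * coeff f (h - b) -
        (if d = b then 1 else 0) =
      ∑ m ∈ Finset.Icc d (N : ℤ), coeff (fun z => (ψ z)⁻¹) (m - d) *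
        (∑ h ∈ Finset.Icc 1 m, coeff (fun z => (φ z)⁻¹) (m - h) * coeff f (h - b) -
          coeff ψ (b - m)) := by
    have hδ : (if d = b then (1 : ℂ) else 0) =
        ∑ m ∈ Finset.Icc d (N : ℤ), coeff (fun z => (ψ z)⁻¹) (m - d) * coeff ψ (b - m) := by
      simp only [mul_comm _ (coeff ψ _), eq_comm (a := d)]
      rw [w.reflect.sum_coeff_mul_coeff_inv (Finset.Icc_subset_Icc le_rfl hb.2)]
    rw [sum_mul_sum_coeff_inv (fun m => coeff (fun z => (ψ z)⁻¹) (m - d)), hδ,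
      ← Finset.sum_sub_distrib]
    refine Finset.sum_congr rfl fun m hm => ?_
    rw [Finset.mem_Icc] at hm
    rw [mul_sub, Finset.sum_subset (Finset.Icc_subset_Icc le_rfl hm.2)]
    intro h hN hh
    rw [coeff_eq_zero_of_neg w.one_lt w.diff_inv_left, zero_mul]
    rw [Finset.mem_Icc] at hN hh
    omega
  rw [e]
  refine (norm_sum_coeff_mul_le (B := C * √q ^ N) (hS _ d) (by positivity) fun m hm => ?_).trans ?_
  · rw [Finset.mem_Icc] at hm
    refine (hrem m b (by omega)).trans ?_
    gcongr ?_ * ?_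
    nth_rw 1 [← Real.sq_sqrt hq0.le]
    rw [← pow_mul]
    exact pow_le_pow_of_le_one (Real.sqrt_nonneg q) hr1.le (by omega)
  · rw [← mul_assoc]
    gcongr
    linarith [mul_nonneg hS0 hB0]

end IsWienerHopf
-- Evaluation of the double contour integrals
theorem sub_ne_zero_of_norm_lt {z s : ℂ} (h : ‖s‖ < ‖z‖) : z - s ≠ 0 := by
  rw [sub_ne_zero]
  rintro rfl
  exact lt_irrefl _ h

/-- Expanding the Cauchy kernel inside the circle `‖s‖ = η` leaves a finite sum. -/
theorem circleCoeff_div_sub {R η : ℝ} (hη : 0 < η) (hηR : η < R) {F : ℂ → ℂ}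
    (hF : DifferentiableOn ℂ F (Metric.ball 0 R)) {z : ℂ} (hz : η < ‖z‖) {n : ℤ} {K : ℕ}
    (hK : n < K) :
    circleCoeff η (fun s => F s / (z - s)) n =
      ∑ k ∈ Finset.range K, (z ^ (k + 1))⁻¹ * circleCoeff η F (n - k) := by
  have hz0 : z ≠ 0 := norm_pos_iff.1 (hη.trans hz)
  have hFη : ContinuousOn F (Metric.sphere 0 η) := hF.continuousOn.mono fun s hs => by
    rw [mem_ball_zero_iff, mem_sphere_zero_iff_norm.1 hs]; exact hηR
  have hd : DifferentiableOn ℂ (fun s => F s / (z - s)) (Metric.ball 0 (min R ‖z‖)) := by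
    refine (hF.mono (Metric.ball_subset_ball (min_le_left _ _))).div
      (differentiableOn_id.const_sub z) fun s hs => sub_ne_zero_of_norm_lt ?_
    exact (mem_ball_zero_iff.1 hs).trans_le (min_le_right _ _)
  have hterm : ∀ k ∈ Finset.range K,
      ContinuousOn (fun s => (z ^ (k + 1))⁻¹ * (s ^ (k : ℤ) * F s)) (Metric.sphere 0 η) := by
    intro k _
    simp only [zpow_natCast]
    exact continuousOn_const.mul ((continuousOn_pow k).mul hFη)
  have e : Set.EqOn (fun s => F s / (z - s))
      (fun s => ∑ k ∈ Finset.range K, (z ^ (k + 1))⁻¹ * (s ^ (k : ℤ) * F s) +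
        (z ^ K)⁻¹ * (s ^ (K : ℤ) * (F s / (z - s)))) (Metric.sphere 0 η) := by
    intro s hs
    have hs' : z - s ≠ 0 := sub_ne_zero_of_norm_lt (by rwa [mem_sphere_zero_iff_norm.1 hs])
    simp only [zpow_natCast]
    clear hterm hK
    induction K with
    | zero => simp
    | succ K ih =>
      refine ih.trans ?_
      rw [Finset.sum_range_succ, add_assoc]
      congr 1
      field_simp
      ring
  rw [circleCoeff_congr hη.le e, circleCoeff_add hη, circleCoeff_sum hη _ hterm]
  · simp only [circleCoeff_const_mul, circleCoeff_zpow_mul hη]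
    -- The geometric remainder carries s^K with K > n, so only a coefficient of negative index of a
    -- holomorphic function is left.
    rw [circleCoeff_eq_zero_of_neg hη (lt_min hηR hz) hd (by omega : n - (K : ℤ) < 0), mul_zero,
      add_zero]
  · exact continuousOn_finsetSum _ hterm
  · refine continuousOn_const.mul (ContinuousOn.mul ?_ (hd.continuousOn.mono fun s hs => ?_))
    · simp only [zpow_natCast]; exact continuousOn_pow K
    · rw [mem_ball_zero_iff, mem_sphere_zero_iff_norm.1 hs]; exact lt_min hηR hz

namespace IsWienerHopf

variable {R : ℝ} {φ ψ f : ℂ → ℂ}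

/-- The s-integral picks Taylor coefficients of φ and the z-integral those of 1/φ; the k-th term of
the kernel expansion is the term m = N+1+k of `weight`. For p ≤ N both sides are empty sums. -/
theorem double_circleIntegral (w : IsWienerHopf R φ ψ f) {ηz ηs : ℝ} (hηs : 0 < ηs)
    (hηsz : ηs < ηz) (hηz : ηz < 1) (N p h : ℤ) :
    ((2 * Real.pi * Complex.I)⁻¹ * ∮ z in C(0, ηz),
      (2 * Real.pi * Complex.I)⁻¹ * ∮ s in C(0, ηs),
        (φ z)⁻¹ * φ s * (s ^ (N - p) * z ^ (h - N - 1) / (z - s))) = -weight φ N p h := by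
  have hηz0 : 0 < ηz := hηs.trans hηsz
  have hinner : ∀ z ∈ Metric.sphere (0 : ℂ) ηz,
      ((2 * Real.pi * Complex.I)⁻¹ * ∮ s in C(0, ηs),
        (φ z)⁻¹ * φ s * (s ^ (N - p) * z ^ (h - N - 1) / (z - s))) =
      (∑ k ∈ Finset.range (p - N).toNat, coeff φ (p - N - 1 - k) *
        (z ^ (h - N - 1 - k) * (φ z)⁻¹)) / z ^ ((0 : ℤ) + 1) := by
    intro z hz
    have hz0 := ne_zero_of_mem_sphere_zero hηz0 hz
    rw [mem_sphere_zero_iff_norm] at hz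
    have e1 : (∮ s in C(0, ηs), (φ z)⁻¹ * φ s * (s ^ (N - p) * z ^ (h - N - 1) / (z - s))) =
        (z ^ (h - N - 1) * (φ z)⁻¹) *
          ∮ s in C(0, ηs), φ s / (z - s) / s ^ (p - N - 1 + 1) := by
      rw [← circleIntegral.integral_const_mul]
      refine circleIntegral.integral_congr hηs.le fun s _ => ?_
      have : s ^ (N - p) = (s ^ (p - N - 1 + 1))⁻¹ := by rw [← zpow_neg]; congr 1; ring
      simp only [this]
      ring
    have e2 := circleCoeff_div_sub hηs ((hηsz.trans hηz).trans w.one_lt) w.diff_left (z := z)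
      (by rwa [hz]) (n := p - N - 1) (K := (p - N).toNat) (by omega)
    rw [circleCoeff] at e2
    rw [e1, mul_left_comm, e2, Finset.mul_sum, Finset.sum_div]
    refine Finset.sum_congr rfl fun k _ => ?_
    rw [circleCoeff_eq_coeff w.one_lt hηs ((hηsz.trans hηz).trans w.one_lt) w.diff_left,
      zpow_sub₀ hz0 (h - N - 1), zpow_natCast, zero_add, zpow_one, pow_succ]
    field_simp
  rw [circleIntegral.integral_congr hηz0.le hinner]
  change circleCoeff ηz (fun z => ∑ k ∈ Finset.range (p - N).toNat, coeff φ (p - N - 1 - k) *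
        (z ^ (h - N - 1 - k) * (φ z)⁻¹)) 0 = _
  rw [circleCoeff_sum hηz0]
  · simp only [circleCoeff_const_mul, circleCoeff_zpow_mul hηz0]
    rw [weight, neg_neg]
    refine Finset.sum_nbij' (fun k => N + 1 + k) (fun m => (m - N - 1).toNat) ?_ ?_ ?_ ?_ ?_
    · intro k hk; simp only [Finset.mem_Icc, Finset.mem_range] at *; omega
    · intro m hm; simp only [Finset.mem_Icc, Finset.mem_range] at *; omega
    · intro k hk; omega
    · intro m hm; simp only [Finset.mem_Icc] at *; omega
    · intro k _
      rw [circleCoeff_eq_coeff w.one_lt hηz0 (hηz.trans w.one_lt) w.diff_inv_left]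
      congr 2 <;> ring
  · intro k _ z hz
    have hz0 := ne_zero_of_mem_sphere_zero hηz0 hz
    have hzR : z ∈ Metric.ball (0 : ℂ) R := by
      rw [mem_ball_zero_iff, mem_sphere_zero_iff_norm.1 hz]; exact hηz.trans w.one_lt
    refine (continuousAt_const.mul ((continuousAt_zpow₀ z _ (.inl hz0)).mul
      (w.diff_inv_left.continuousOn.continuousAt
        (Metric.isOpen_ball.mem_nhds hzR)))).continuousWithinAt

/-- Substituting z ↦ 1/z and s ↦ 1/s reduces this to the previous integral with φ and ψ exchanged, p
and h being reflected about (N+1)/2. -/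
theorem double_circleIntegral_inv (w : IsWienerHopf R φ ψ f) {ηz ηs : ℝ} (hηs : 0 < ηs)
    (hηsz : ηs < ηz) (hηz : ηz < 1) {α : ℂ → ℂ} (hα : ∀ z, z ≠ 0 → ‖z‖ < 1 → α z⁻¹ = ψ z)
    (N p h : ℤ) :
    ((2 * Real.pi * Complex.I)⁻¹ * ∮ z in C(0, ηz⁻¹),
      (2 * Real.pi * Complex.I)⁻¹ * ∮ s in C(0, ηs⁻¹),
        α s / α z * (s ^ (-p) * z ^ (h - 1) / (z - s))) =
      weight ψ N (N + 1 - p) (N + 1 - h) := by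
  have hηz0 : 0 < ηz := hηs.trans hηsz
  have key := w.reflect.double_circleIntegral hηs hηsz hηz N (N + 1 - p) (N + 1 - h)
  rw [eq_neg_iff_add_eq_zero, add_comm, ← eq_neg_iff_add_eq_zero] at key
  rw [key, circleIntegral_inv_radius hηz0, ← mul_neg]
  refine congrArg ((2 * Real.pi * Complex.I : ℂ)⁻¹ * ·) ?_
  rw [neg_eq_neg_one_mul (circleIntegral _ _ _), ← circleIntegral.integral_const_mul (-1)]
  refine circleIntegral.integral_congr hηz0.le fun z hz => ?_
  have hz0 := ne_zero_of_mem_sphere_zero hηz0 hz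
  rw [mem_sphere_zero_iff_norm] at hz
  rw [mul_assoc, mul_left_comm (-1)]
  refine congrArg ((2 * Real.pi * Complex.I : ℂ)⁻¹ * ·) ?_
  rw [circleIntegral_inv_radius hηs, mul_comm _ (z ^ 2)⁻¹,
    ← circleIntegral.integral_const_mul (z ^ 2)⁻¹, ← circleIntegral.integral_const_mul (-1)]
  refine circleIntegral.integral_congr hηs.le fun s hs => ?_
  have hs0 := ne_zero_of_mem_sphere_zero hηs hs
  rw [mem_sphere_zero_iff_norm] at hs
  have hzR : z ∈ Metric.ball (0 : ℂ) R := by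
    rw [mem_ball_zero_iff, hz]; exact hηz.trans w.one_lt
  have hψ := w.right_ne_zero z hzR
  have hzs : z - s ≠ 0 := sub_ne_zero_of_norm_lt (by rwa [hz, hs])
  have hsz : s - z ≠ 0 := by rw [← neg_sub]; exact neg_ne_zero.2 hzs
  have e1 : s ^ (N - (N + 1 - p)) = s ^ p * s⁻¹ := by
    rw [← zpow_sub_one₀ hs0]; congr 1; ring
  have e2 : z ^ (N + 1 - h - N - 1) = (z ^ h)⁻¹ := by rw [← zpow_neg]; congr 1; ring
  have e3 : z⁻¹ ^ (h - 1) = (z ^ h)⁻¹ * z := by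
    rw [inv_zpow, zpow_sub_one₀ hz0, mul_inv, inv_inv]
  have e4 : s⁻¹ ^ (-p) = s ^ p := by rw [inv_zpow', neg_neg]
  have e5 : z⁻¹ - s⁻¹ = (s - z) * (z⁻¹ * s⁻¹) := by field_simp
  have hzh := zpow_ne_zero h hz0
  have hsp := zpow_ne_zero p hs0
  simp only [hα s hs0 (by linarith), hα z hz0 (by linarith), e1, e2, e3, e4, e5]
  field_simp
  ring

end IsWienerHopf
-- Reflection: rows on both sides, approximate inverse, entries of M
theorem sum_Icc_reflect (N : ℤ) (F : ℤ → ℂ) :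
    ∑ h ∈ Finset.Icc 1 N, F (N + 1 - h) = ∑ h ∈ Finset.Icc 1 N, F h := by
  refine Finset.sum_nbij' (fun h => N + 1 - h) (fun h => N + 1 - h) ?_ ?_ ?_ ?_ ?_
  · intro h hh; rw [Finset.mem_Icc] at *; omega
  · intro h hh; rw [Finset.mem_Icc] at *; omega
  · intro h _; ring
  · intro h _; ring
  · intro h _; rfl

theorem sum_fin_eq_sum_Icc (N : ℕ) (F : ℤ → ℂ) :
    ∑ i : Fin N, F ((i : ℤ) + 1) = ∑ h ∈ Finset.Icc (1 : ℤ) N, F h := by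
  refine Finset.sum_nbij (fun i : Fin N => (i : ℤ) + 1) ?_ ?_ ?_ ?_
  · intro i _; rw [Finset.mem_Icc]; omega
  · intro i _ j _ hij; simp only at hij; ext; omega
  · intro h hh
    simp only [Finset.coe_Icc, Set.mem_Icc] at hh
    exact ⟨⟨(h - 1).toNat, by omega⟩, by simp, by simp; omega⟩
  · intro i _; rfl

namespace IsWienerHopf

variable {R : ℝ} {φ ψ f : ℂ → ℂ}

/-- The weights of `weight`, extended by reflection to the rows `p ≤ 0`. -/
noncomputable def rowWeight (φ ψ : ℂ → ℂ) (N p h : ℤ) : ℂ :=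
  if 0 < p then weight φ N p h else weight ψ N (N + 1 - p) (N + 1 - h)

theorem exists_rowWeight_bound (w : IsWienerHopf R φ ψ f) :
    ∃ C q : ℝ, 0 ≤ C ∧ 0 < q ∧ q < 1 ∧ ∀ (N : ℕ) (p : ℤ), p ∉ Set.Icc (1 : ℤ) N →
      (∀ h, ‖rowWeight φ ψ N p h‖ ≤ C) ∧
      ∀ b ∈ Finset.Icc (1 : ℤ) N,
        ‖coeff f (p - b) - ∑ h ∈ Finset.Icc (1 : ℤ) N, rowWeight φ ψ N p h * coeff f (h - b)‖
          ≤ C * q ^ N := by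
  obtain ⟨C₁, q₁, hC₁, hq₁, hq₁', H₁⟩ := w.exists_row_bound
  obtain ⟨C₂, q₂, hC₂, hq₂, hq₂', H₂⟩ := w.reflect.exists_row_bound
  refine ⟨max C₁ C₂, max q₁ q₂, le_max_of_le_left hC₁, lt_max_of_lt_left hq₁,
    max_lt hq₁' hq₂', fun N p hp => ?_⟩
  rw [Set.mem_Icc, not_and_or, not_le, not_le] at hp
  by_cases h0 : 0 < p
  · simp only [rowWeight, if_pos h0]
    obtain ⟨h1, h2⟩ := H₁ N p (by omega)
    refine ⟨fun h => (h1 h).trans (le_max_left _ _), fun b hb => (h2 b hb).trans ?_⟩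
    gcongr
    · exact le_max_left _ _
    · exact le_max_left _ _
  · simp only [rowWeight, if_neg h0]
    obtain ⟨h1, h2⟩ := H₂ N (N + 1 - p) (by omega)
    refine ⟨fun h => (h1 _).trans (le_max_right _ _), fun b hb => ?_⟩
    have h3 := h2 (N + 1 - b) (by rw [Finset.mem_Icc] at *; omega)
    rw [← sum_Icc_reflect] at h3
    simp only [coeff_comp_inv] at h3
    have e1 : -((N : ℤ) + 1 - p - (N + 1 - b)) = p - b := by ring
    have e2 : ∀ h : ℤ, -((N : ℤ) + 1 - h - (N + 1 - b)) = h - b := fun h => by ring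
    simp only [e1, e2] at h3
    refine h3.trans ?_
    gcongr
    · exact le_max_right _ _
    · exact le_max_right _ _

theorem exists_approx_inverse (w : IsWienerHopf R φ ψ f) :
    ∃ C q : ℝ, 0 ≤ C ∧ 0 < q ∧ q < 1 ∧ ∀ (N : ℕ) (d : ℤ),
      ∃ x : ℤ → ℂ, (∀ h, ‖x h‖ ≤ C) ∧
      ∀ b ∈ Finset.Icc (1 : ℤ) N,
        ‖∑ h ∈ Finset.Icc (1 : ℤ) N, x h * coeff f (h - b) - if d = b then 1 else 0‖
          ≤ C * q ^ N := by
  obtain ⟨C₁, q₁, hC₁, hq₁, hq₁', H₁⟩ := w.exists_inverse_row_bound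
  obtain ⟨C₂, q₂, hC₂, hq₂, hq₂', H₂⟩ := w.reflect.exists_inverse_row_bound
  refine ⟨max C₁ C₂, max q₁ q₂, le_max_of_le_left hC₁, lt_max_of_lt_left hq₁,
    max_lt hq₁' hq₂', fun N d => ?_⟩
  by_cases h0 : (N : ℤ) + 1 ≤ 2 * d
  · obtain ⟨x, h1, h2⟩ := H₁ N d h0
    refine ⟨x, fun h => (h1 h).trans (le_max_left _ _), fun b hb => (h2 b hb).trans ?_⟩
    gcongr
    · exact le_max_left _ _
    · exact le_max_left _ _
  · obtain ⟨x, h1, h2⟩ := H₂ N (N + 1 - d) (by omega)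
    refine ⟨fun h => x (N + 1 - h), fun h => (h1 _).trans (le_max_right _ _), fun b hb => ?_⟩
    have h3 := h2 (N + 1 - b) (by rw [Finset.mem_Icc] at *; omega)
    rw [← sum_Icc_reflect] at h3
    simp only [coeff_comp_inv] at h3
    have e2 : ∀ h : ℤ, -((N : ℤ) + 1 - h - (N + 1 - b)) = h - b := fun h => by ring
    simp only [e2, sub_right_inj] at h3
    refine h3.trans ?_
    gcongr
    · exact le_max_right _ _
    · exact le_max_right _ _

theorem M_apply (w : IsWienerHopf R φ ψ f) {g : ℂ → ℂ}
    (hin : ∀ z, ‖z‖ < 1 → alpha g z = (φ z)⁻¹)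
    (hout : ∀ z, z ≠ 0 → ‖z‖ < 1 → alpha g z⁻¹ = ψ z)
    {ηz ηs : ℝ} (hηs : 0 < ηs) (hηsz : ηs < ηz) (hηz : ηz < 1) {N n : ℕ} {h p : Fin n → ℤ}
    (hp : ∀ k, p k ∉ Set.Icc (1 : ℤ) N) (a b : Fin n) :
    M g ηz ηs N h p a b = rowWeight φ ψ N (p a) (h b) := by
  have e1 : ((2 * Real.pi * Complex.I)⁻¹ * ∮ z in C(0, ηz),
      (2 * Real.pi * Complex.I)⁻¹ * ∮ s in C(0, ηs),
        alpha g z / alpha g s * (s ^ ((N : ℤ) - p a) * z ^ (h b - N - 1) / (z - s))) =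
      -weight φ N (p a) (h b) := by
    rw [← w.double_circleIntegral hηs hηsz hηz]
    congr 1
    refine circleIntegral.integral_congr (hηs.trans hηsz).le fun z hz => ?_
    refine congrArg ((2 * Real.pi * Complex.I : ℂ)⁻¹ * ·) ?_
    refine circleIntegral.integral_congr hηs.le fun s hs => ?_
    rw [mem_sphere_zero_iff_norm] at hz hs
    simp only [hin z (by linarith), hin s (by linarith), div_inv_eq_mul]
  have e2 := w.double_circleIntegral_inv hηs hηsz hηz hout N (p a) (h b)
  have hpa := hp a
  rw [Set.mem_Icc, not_and_or, not_le, not_le] at hpa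
  simp only [M, Matrix.of_apply, e1, e2, rowWeight]
  rcases lt_trichotomy (p a) 0 with h0 | h0 | h0
  · rw [if_neg (by omega), if_pos (by omega), if_neg (by omega)]; simp
  -- At p = 0 both indicators are on, but the first integral is an empty sum, so nothing is counted
  -- twice.
  · rw [if_pos (by omega), if_pos (by omega), if_neg (by omega)]
    rw [weight, Finset.Icc_eq_empty (by omega)]; simp
  · rw [if_pos (by omega), if_neg (by omega), if_pos (by omega)]; simp

end IsWienerHopf

/-! ### Determinants and perturbation -/

section LinearAlgebra

/-- The modified matrix is (1 + SY)T with S the inclusion of the replaced rows and Y = y - Sᵀ. The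
identity det(1 + SY) = det(1 + YS) reduces the first factor to size n. Invertibility of T is not
needed. -/
theorem det_eq_det_mul_of_rows {N n : ℕ} {T L : Matrix (Fin N) (Fin N) ℂ} {i : Fin n → Fin N}
    (hi : Function.Injective i) {y : Matrix (Fin n) (Fin N) ℂ}
    (h1 : ∀ k j, L (i k) j = (y * T) k j) (h2 : ∀ a, (∀ k, i k ≠ a) → ∀ j, L a j = T a j) :
    L.det = T.det * (Matrix.of fun a b => y a (i b)).det := by
  set S : Matrix (Fin N) (Fin n) ℂ := Matrix.of fun a k => if a = i k then 1 else 0 with hS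
  set Y : Matrix (Fin n) (Fin N) ℂ := y - S.transpose with hY
  have hL : L = (1 + S * Y) * T := by
    ext a j
    rw [add_mul, one_mul, Matrix.mul_assoc, Matrix.add_apply, Matrix.mul_apply]
    by_cases ha : ∃ k, i k = a
    · obtain ⟨k, rfl⟩ := ha
      rw [Finset.sum_eq_single k]
      · simp [hS, hY, h1, Matrix.mul_apply, sub_mul, Finset.sum_sub_distrib]
      · intro l _ hl
        simp [hS, hi.eq_iff, hl.symm]
      · simp
    · push Not at ha
      rw [Finset.sum_eq_zero, add_zero, h2 a ha]
      intro k _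
      simp [hS, (ha k).symm]
  have hYS : 1 + Y * S = Matrix.of fun a b => y a (i b) := by
    ext a b
    simp only [hY, hS, Matrix.sub_mul, Matrix.add_apply, Matrix.sub_apply, Matrix.mul_apply,
      Matrix.transpose_apply, Matrix.of_apply, mul_ite, mul_one, mul_zero, Finset.sum_ite_eq',
      Finset.mem_univ, if_true, Matrix.one_apply, hi.eq_iff, eq_comm (a := b)]
    ring
  rw [hL, Matrix.det_mul, Matrix.det_one_add_mul_comm, hYS, mul_comm]

/-- With XT = 1 + D and D small, solve u(1 + D) = E and take v = uX. -/
theorem exists_vecMul_eq {N : ℕ} {T X : Matrix (Fin N) (Fin N) ℂ} {C δ e : ℝ}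
    (he : 0 ≤ e) (hX : ∀ i j, ‖X i j‖ ≤ C) (hD : ∀ i j, ‖(X * T - 1) i j‖ ≤ δ)
    (hδ : N * δ ≤ 1 / 2) {E : Fin N → ℂ} (hE : ∀ j, ‖E j‖ ≤ e) :
    ∃ v : Fin N → ℂ, Matrix.vecMul v T = E ∧ ∀ j, ‖v j‖ ≤ 2 * N * C * e := by
  set D := X * T - 1 with hDdef
  have hXT : X * T = 1 + D := by rw [hDdef]; abel
  -- The row sums of |D| are at most 1/2, so 1 + D is strictly diagonally dominant.
  have hdet : (1 + D).det ≠ 0 := by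
    refine det_ne_zero_of_sum_row_lt_diag fun k => ?_
    have h1 : ∑ j ∈ Finset.univ.erase k, ‖(1 + D) k j‖ = ∑ j, ‖D k j‖ - ‖D k k‖ := by
      rw [← Finset.sum_erase_add _ _ (Finset.mem_univ k), add_sub_cancel_right]
      refine Finset.sum_congr rfl fun j hj => ?_
      rw [Matrix.add_apply, Matrix.one_apply_ne (Finset.ne_of_mem_erase hj).symm, zero_add]
    have h2 : ∑ j, ‖D k j‖ ≤ N * δ := by
      simpa using Finset.sum_le_card_nsmul Finset.univ _ δ fun j _ => hD k j
    have h3 : 1 - ‖D k k‖ ≤ ‖(1 + D) k k‖ := by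
      rw [Matrix.add_apply, Matrix.one_apply_eq]
      have := norm_sub_norm_le (1 : ℂ) (-D k k)
      rwa [norm_one, norm_neg, sub_neg_eq_add] at this
    linarith
  set u := Matrix.vecMul E (1 + D)⁻¹ with hu
  have hu1 : Matrix.vecMul u (1 + D) = E := by
    rw [hu, Matrix.vecMul_vecMul, Matrix.nonsing_inv_mul _ (isUnit_iff_ne_zero.2 hdet),
      Matrix.vecMul_one]
  have hsum : ∀ (A : Matrix (Fin N) (Fin N) ℂ) (x : Fin N → ℂ) (b c : ℝ), 0 ≤ b →
      (∀ i, ‖x i‖ ≤ b) → (∀ i j, ‖A i j‖ ≤ c) → ∀ j, ‖Matrix.vecMul x A j‖ ≤ N * (b * c) := by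
    intro A x b c hb hx hA j
    refine (norm_sum_le_of_le (f := fun i => x i * A i j) _ fun i _ => ?_).trans_eq
      (?_ : ∑ _i : Fin N, b * c = _)
    · rw [norm_mul]; exact mul_le_mul (hx i) (hA i j) (norm_nonneg _) hb
    · simp
  have hu2 : ∀ j, ‖u j‖ ≤ 2 * e := by
    intro j
    have : Nonempty (Fin N) := ⟨j⟩
    obtain ⟨m, hm⟩ := Finite.exists_max fun i => ‖u i‖
    have h1 := hsum D u ‖u m‖ δ (norm_nonneg _) hm hD m
    have h2 : u m = E m - Matrix.vecMul u D m := by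
      rw [← hu1, Matrix.vecMul_add, Matrix.vecMul_one, Pi.add_apply, add_sub_cancel_right]
    -- At an entry of largest modulus, u = E - uD gives |u_m| ≤ e + |u_m|/2.
    have h3 : ‖u m‖ ≤ e + N * (‖u m‖ * δ) := by
      conv_lhs => rw [h2]
      exact (norm_sub_le _ _).trans (add_le_add (hE m) h1)
    have h4 := mul_le_mul_of_nonneg_left hδ (norm_nonneg (u m))
    refine (hm j).trans ?_
    linarith
  refine ⟨Matrix.vecMul u X, ?_, fun j => ?_⟩
  · rw [Matrix.vecMul_vecMul, hXT, hu1]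
  · refine (hsum X u (2 * e) C (by positivity) hu2 hX j).trans_eq ?_
    ring

theorem norm_prod_add_sub_prod_le {ι : Type*} (s : Finset ι) {x d : ι → ℂ} {B e : ℝ}
    (he : 0 ≤ e) (he1 : e ≤ 1) (hx : ∀ i, ‖x i‖ ≤ B) (hd : ∀ i, ‖d i‖ ≤ e) :
    ‖∏ i ∈ s, (x i + d i) - ∏ i ∈ s, x i‖ ≤ s.card * (B + 1) ^ s.card * e := by
  classical
  induction s using Finset.induction_on with
  | empty => simp
  | insert a s ha ih =>
    have hB : 0 ≤ B := (norm_nonneg _).trans (hx a)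
    rw [Finset.prod_insert ha, Finset.prod_insert ha, Finset.card_insert_of_notMem ha]
    have e1 : (x a + d a) * ∏ i ∈ s, (x i + d i) - x a * ∏ i ∈ s, x i =
        (x a + d a) * (∏ i ∈ s, (x i + d i) - ∏ i ∈ s, x i) + d a * ∏ i ∈ s, x i := by ring
    have h1 : ‖x a + d a‖ ≤ B + 1 :=
      (norm_add_le _ _).trans (add_le_add (hx a) ((hd a).trans he1))
    have h2 : ‖∏ i ∈ s, x i‖ ≤ (B + 1) ^ (s.card + 1) := by
      rw [norm_prod]
      refine (Finset.prod_le_prod (g := fun _ => B + 1) (fun _ _ => norm_nonneg _)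
        fun i _ => (hx i).trans (by linarith)).trans ?_
      rw [Finset.prod_const]
      exact pow_le_pow_right₀ (by linarith) (by omega)
    rw [e1]
    refine (norm_add_le _ _).trans ?_
    rw [norm_mul, norm_mul]
    refine (add_le_add (mul_le_mul h1 ih (norm_nonneg _) (by positivity))
      (mul_le_mul (hd a) h2 (norm_nonneg _) he)).trans_eq ?_
    push_cast
    ring

theorem norm_det_add_sub_det_le {n : ℕ} {A D : Matrix (Fin n) (Fin n) ℂ} {B e : ℝ}
    (he : 0 ≤ e) (he1 : e ≤ 1) (hA : ∀ i j, ‖A i j‖ ≤ B) (hD : ∀ i j, ‖D i j‖ ≤ e) :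
    ‖(A + D).det - A.det‖ ≤ n.factorial * (n * (B + 1) ^ n) * e := by
  rw [Matrix.det_apply', Matrix.det_apply', ← Finset.sum_sub_distrib]
  refine (norm_sum_le_of_le _ fun σ _ => ?_).trans_eq
    (?_ : ∑ _σ : Equiv.Perm (Fin n), n * (B + 1) ^ n * e = _)
  · rw [← mul_sub, norm_mul]
    have hs : ‖((Equiv.Perm.sign σ : ℤ) : ℂ)‖ = 1 := by
      rcases Int.units_eq_one_or (Equiv.Perm.sign σ) with h | h <;> simp [h]
    rw [hs, one_mul]
    simpa using norm_prod_add_sub_prod_le Finset.univ (x := fun i => A (σ i) i)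
      (d := fun i => D (σ i) i) he he1 (fun i => hA _ _) (fun i => hD _ _)
  · rw [Finset.sum_const, Finset.card_univ, Fintype.card_perm, Fintype.card_fin, nsmul_eq_mul]
    ring

end LinearAlgebra

/-! ### Exact row relations and the determinant formula -/

theorem eventually_pow_mul_pow_le {q c : ℝ} (hq0 : 0 < q) (hq1 : q < 1) (hc : 0 < c) (k : ℕ) :
    ∀ᶠ N : ℕ in atTop, (N : ℝ) ^ k * q ^ N ≤ c :=
  (tendsto_pow_const_mul_const_pow_of_lt_one k hq0.le hq1).eventually_le_const hc

theorem rapidlyDecaying_mul_pow_mul_pow {q : ℝ} (hq0 : 0 < q) (hq1 : q < 1) (C : ℝ) (j : ℕ) :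
    RapidlyDecaying fun N => C * ((N : ℝ) ^ j * q ^ N) := by
  intro K
  refine IsBigO.const_mul_left (IsBigO.of_bound 1 ?_) C
  filter_upwards [eventually_pow_mul_pow_le hq0 hq1 one_pos (j + K), eventually_gt_atTop 0]
    with N hN hN0
  have hN0' : (0 : ℝ) < N := by exact_mod_cast hN0
  rw [one_mul, Real.norm_of_nonneg (by positivity), Real.norm_of_nonneg (by positivity),
    ← one_div, le_div_iff₀ (by positivity)]
  refine le_trans (le_of_eq ?_) hN
  rw [pow_add]
  ring

namespace IsWienerHopf

variable {R : ℝ} {φ ψ f : ℂ → ℂ}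

/-- For large `N` every row `p ∉ {1, …, N}` is exactly a combination of the rows `1, …, N`, with
weights exponentially close to `rowWeight`. -/
theorem exists_row_solution (w : IsWienerHopf R φ ψ f) :
    ∃ C q : ℝ, 0 ≤ C ∧ 0 < q ∧ q < 1 ∧ ∀ᶠ N : ℕ in atTop, ∀ p : ℤ, p ∉ Set.Icc (1 : ℤ) N →
      (∀ h, ‖rowWeight φ ψ N p h‖ ≤ C) ∧
      ∃ y : Fin N → ℂ, (∀ j : Fin N, ‖y j - rowWeight φ ψ N p (j + 1)‖ ≤ C * (N * q ^ N)) ∧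
        ∀ b : Fin N, Matrix.vecMul y (toeplitz f N) b = coeff f (p - (b + 1)) := by
  obtain ⟨C₁, q₁, hC₁, hq₁, hq₁', H₁⟩ := w.exists_rowWeight_bound
  obtain ⟨C₂, q₂, hC₂, hq₂, hq₂', H₂⟩ := w.exists_approx_inverse
  refine ⟨C₁ + 2 * C₂ * C₁, q₁, by positivity, hq₁, hq₁', ?_⟩
  have hev : ∀ᶠ N : ℕ in atTop, N * (C₂ * q₂ ^ N) ≤ 1 / 2 := by
    filter_upwards [eventually_pow_mul_pow_le hq₂ hq₂'
      (show 0 < 1 / (2 * (C₂ + 1)) by positivity) 1] with N hN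
    rw [pow_one, le_div_iff₀ (by positivity)] at hN
    have : 0 ≤ N * q₂ ^ N := by positivity
    nlinarith
  filter_upwards [hev] with N hN p hp
  obtain ⟨hW, hrow⟩ := H₁ N p hp
  refine ⟨fun h => (hW h).trans (by nlinarith), ?_⟩
  choose x hx hxT using fun d : Fin N => H₂ N ((d : ℤ) + 1)
  have hmem : ∀ b : Fin N, (b : ℤ) + 1 ∈ Finset.Icc (1 : ℤ) N := fun b => by
    rw [Finset.mem_Icc]; omega
  have hX : ∀ i j, ‖((Matrix.of fun d h : Fin N => x d ((h : ℤ) + 1)) * toeplitz f N - 1) i j‖ ≤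
      C₂ * q₂ ^ N := fun i j => by
    refine le_trans (le_of_eq ?_) (hxT i _ (hmem j))
    rw [Matrix.sub_apply, Matrix.mul_apply, Matrix.one_apply, ← sum_fin_eq_sum_Icc]
    simp [toeplitz, Fin.ext_iff]
  have hE : ∀ b : Fin N, ‖coeff f (p - (b + 1)) -
      Matrix.vecMul (fun h : Fin N => rowWeight φ ψ N p (h + 1)) (toeplitz f N) b‖ ≤
      C₁ * q₁ ^ N := fun b => by
    refine le_trans (le_of_eq ?_) (hrow _ (hmem b))
    rw [← sum_fin_eq_sum_Icc]
    rfl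
  -- The residual of the approximate relation is itself written as vT; adding v to the weights makes
  -- the relation exact.
  obtain ⟨v, hv, hvb⟩ := exists_vecMul_eq (by positivity) (fun i j => hx i _) hX hN hE
  refine ⟨fun j => rowWeight φ ψ N p (j + 1) + v j, fun j => ?_, fun b => ?_⟩
  · rw [add_sub_cancel_left]
    refine (hvb j).trans ?_
    have : 0 ≤ C₁ * (N * q₁ ^ N) := by positivity
    linarith
  · have : (fun j : Fin N => rowWeight φ ψ N p (j + 1) + v j) =
      (fun j : Fin N => rowWeight φ ψ N p (j + 1)) + v := rfl
    rw [this, Matrix.add_vecMul, hv, Pi.add_apply, add_sub_cancel]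

theorem exists_det_lacunaryToeplitz (w : IsWienerHopf R φ ψ f) {g : ℂ → ℂ}
    (hin : ∀ z, ‖z‖ < 1 → alpha g z = (φ z)⁻¹)
    (hout : ∀ z, z ≠ 0 → ‖z‖ < 1 → alpha g z⁻¹ = ψ z)
    {ηz ηs : ℝ} (hηs : 0 < ηs) (hηsz : ηs < ηz) (hηz : ηz < 1) (n : ℕ) :
    ∃ C q : ℝ, 0 ≤ C ∧ 0 < q ∧ q < 1 ∧
      ∀ᶠ N : ℕ in atTop, ∀ h p : Fin n → ℤ, Admissible N h p →
        ∃ r : ℂ, ‖r‖ ≤ C * ((N : ℝ) ^ 1 * q ^ N) ∧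
          (lacunaryToeplitz f N h p).det =
            (toeplitz f N).det * ((M g ηz ηs N h p).det + r) := by
  obtain ⟨C, q, hC, hq0, hq1, H⟩ := w.exists_row_solution
  refine ⟨n.factorial * (n * (C + 1) ^ n) * C, q, by positivity, hq0, hq1, ?_⟩
  -- The smallness condition makes the entrywise perturbation C N q^N at most 1, as the determinant
  -- estimate requires.
  filter_upwards [H, eventually_pow_mul_pow_le hq0 hq1 (show 0 < 1 / (C + 1) by positivity) 1]
    with N hN hsmall h p hhp
  rw [le_div_iff₀ (by positivity), pow_one] at hsmall
  have hNq : 0 ≤ N * q ^ N := by positivity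
  choose hW y hy hyT using fun k => hN (p k) (hhp.p_notMem k)
  have hi : ∀ k, ∃ i : Fin N, (i : ℤ) + 1 = h k := fun k => by
    obtain ⟨h1, h2⟩ := hhp.h_mem k
    exact ⟨⟨(h k - 1).toNat, by omega⟩, by simp; omega⟩
  choose i hi using hi
  have hinj : Function.Injective i := fun k l hkl => hhp.h_inj (by rw [← hi, ← hi, hkl])
  have hdet := det_eq_det_mul_of_rows (T := toeplitz f N) (L := lacunaryToeplitz f N h p) hinj
    (y := Matrix.of y) (fun k j => ?_) (fun a ha j => ?_)
  · refine ⟨(Matrix.of fun a b => y a (i b)).det - (M g ηz ηs N h p).det, ?_, ?_⟩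
    · have e : (Matrix.of fun a b => y a (i b)) = M g ηz ηs N h p +
        Matrix.of fun a b => y a (i b) - rowWeight φ ψ N (p a) (h b) := by
        ext a b
        rw [Matrix.add_apply, w.M_apply hin hout hηs hηsz hηz hhp.p_notMem]
        simp
      rw [e, mul_assoc, pow_one]
      refine norm_det_add_sub_det_le (by positivity) (by nlinarith) (fun a b => ?_) fun a b => ?_
      · rw [w.M_apply hin hout hηs hηsz hηz hhp.p_notMem]
        exact hW a _
      · rw [Matrix.of_apply, ← hi b]
        exact hy a (i b)
    · rw [hdet, add_sub_cancel]
      rfl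
  · refine Eq.trans ?_ (hyT k j).symm
    simp only [lacunaryToeplitz, Matrix.of_apply, hi, ell, hhp.h_inj.extend_apply]
  · simp only [lacunaryToeplitz, toeplitz, Matrix.of_apply, ell]
    rw [Function.extend_apply', id]
    rintro ⟨k, hk⟩
    refine ha k ?_
    have := hi k
    ext
    omega

end IsWienerHopf

/-! ### Construction of the factorization from ln f -/

/-- By compactness U contains an annulus 1 ≤ |z| ≤ 1 + δ; moving the contour to its outer circle
gives the rate 1/(1 + δ). -/
theorem exists_norm_coeff_le_of_isOpen {g : ℂ → ℂ} {U : Set ℂ} (hU : IsOpen U)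
    (hUc : Metric.sphere (0 : ℂ) 1 ⊆ U) (hg : DifferentiableOn ℂ g U) :
    ∃ C q : ℝ, 0 < q ∧ q < 1 ∧ ∀ k : ℕ, ‖coeff g k‖ ≤ C * q ^ k := by
  obtain ⟨δ, hδ, hsub⟩ := (isCompact_sphere (0 : ℂ) 1).exists_cthickening_subset_open hU hUc
  have hann : ∀ z : ℂ, 1 ≤ ‖z‖ → ‖z‖ ≤ 1 + δ → DifferentiableAt ℂ g z := by
    intro z h1 h2
    have hz0 : (‖z‖ : ℂ) ≠ 0 := by
      rw [Complex.ofReal_ne_zero]; linarith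
    refine hg.differentiableAt (hU.mem_nhds (hsub ?_))
    refine Metric.mem_cthickening_of_dist_le z (z / ‖z‖) δ _ ?_ ?_
    · rw [mem_sphere_zero_iff_norm, norm_div, Complex.norm_real, norm_norm, div_self]
      linarith
    · have e : z - z / ‖z‖ = ((‖z‖ - 1 : ℝ) : ℂ) * (z / ‖z‖) := by
        push_cast; field_simp
      rw [dist_eq_norm, e, norm_mul, norm_div, Complex.norm_real, Complex.norm_real, norm_norm,
        div_self (by linarith), mul_one, Real.norm_of_nonneg (by linarith)]
      linarith
  have hρ : (0 : ℝ) < 1 + δ := by linarith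
  have hc : ContinuousOn g (Metric.sphere 0 (1 + δ)) := fun z hz => by
    rw [mem_sphere_zero_iff_norm] at hz
    exact (hann z (by linarith) hz.le).continuousAt.continuousWithinAt
  obtain ⟨B, hB⟩ := (isCompact_sphere (0 : ℂ) (1 + δ)).exists_bound_of_continuousOn hc
  refine ⟨B, (1 + δ)⁻¹, inv_pos.2 hρ, inv_lt_one_of_one_lt₀ (by linarith), fun k => ?_⟩
  rw [coeff_eq_circleCoeff, ← circleCoeff_eq_of_annulus one_pos (by linarith) hann]
  simpa using norm_circleCoeff_le hρ hB k

theorem exists_norm_coeff_neg_le_of_isOpen {g : ℂ → ℂ} {U : Set ℂ} (hU : IsOpen U)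
    (hUc : Metric.sphere (0 : ℂ) 1 ⊆ U) (hg : DifferentiableOn ℂ g U) :
    ∃ C q : ℝ, 0 < q ∧ q < 1 ∧ ∀ k : ℕ, ‖coeff g (-k)‖ ≤ C * q ^ k := by
  obtain ⟨C, q, h0, h1, h⟩ := exists_norm_coeff_le_of_isOpen (g := fun z => g z⁻¹)
    (U := {0}ᶜ ∩ Inv.inv ⁻¹' U)
    ((continuousOn_inv₀ (G₀ := ℂ)).isOpen_inter_preimage isOpen_compl_singleton hU)
    (fun z hz => ⟨ne_zero_of_mem_sphere_zero one_pos hz, hUc (IsWienerHopf.inv_mem_sphere hz)⟩)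
    (hg.comp (fun z hz => (differentiableAt_inv hz.1).differentiableWithinAt) fun z hz => hz.2)
  exact ⟨C, q, h0, h1, fun k => by rw [← coeff_comp_inv]; exact h k⟩

/-- A continuous function on the unit circle with summable Laurent coefficients is the sum of its
Laurent series. -/
theorem hasSum_coeff_mul_zpow {g : ℂ → ℂ} (hg : ContinuousOn g (Metric.sphere 0 1))
    (hs : Summable fun k : ℤ => coeff g k) {z : ℂ} (hz : z ∈ Metric.sphere (0 : ℂ) 1) :
    HasSum (fun k : ℤ => coeff g k * z ^ k) (g z) := by
  have hT : Fact (0 < 2 * Real.pi) := ⟨Real.two_pi_pos⟩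
  let G : C(AddCircle (2 * Real.pi), ℂ) := ⟨fun x => g (x.toCircle : ℂ),
    hg.comp_continuous (continuous_subtype_val.comp AddCircle.continuous_toCircle)
      fun x => by rw [mem_sphere_zero_iff_norm, Circle.norm_coe]⟩
  have hmap : ∀ x : ℝ, (AddCircle.toCircle (x : AddCircle (2 * Real.pi)) : ℂ) = circleMap 0 1 x := by
    intro x
    rw [AddCircle.toCircle_apply_mk, Circle.coe_exp, circleMap_zero, Complex.ofReal_one, one_mul,
      div_self Real.two_pi_pos.ne', one_mul]
  have hfour : ∀ (n : ℤ) (x : ℝ),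
      (fourier n (x : AddCircle (2 * Real.pi)) : ℂ) = circleMap 0 1 x ^ n := by
    intro n x
    rw [fourier_apply, AddCircle.toCircle_zsmul, Circle.coe_zpow, hmap]
  have hcoeff : fourierCoeff G = coeff g := by
    ext n
    rw [fourierCoeff_eq_intervalIntegral _ n 0, zero_add, coeff, circleIntegral,
      Complex.real_smul, ← intervalIntegral.integral_const_mul,
      ← intervalIntegral.integral_const_mul]
    refine intervalIntegral.integral_congr fun x _ => ?_
    have h0 : circleMap 0 1 x ≠ 0 := circleMap_ne_center one_ne_zero
    have hGx : G (x : AddCircle (2 * Real.pi)) = g (circleMap 0 1 x) := congrArg g (hmap x)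
    simp only [hfour, hGx, deriv_circleMap, smul_eq_mul, zpow_neg, zpow_add_one₀ h0]
    have hpi : (Real.pi : ℂ) ≠ 0 := by exact_mod_cast Real.pi_ne_zero
    have hI := Complex.I_ne_zero
    push_cast
    field_simp
  obtain ⟨x, -, rfl⟩ : z ∈ circleMap 0 1 '' Set.Ioc 0 (2 * Real.pi) := by
    rw [image_circleMap_Ioc, abs_one]; exact hz
  have := has_pointwise_sum_fourier_series_of_summable (f := G) (by rw [hcoeff]; exact hs) x
  rw [hcoeff] at this
  simp only [hfour, smul_eq_mul] at this
  rwa [show G (x : AddCircle (2 * Real.pi)) = g (circleMap 0 1 x) from congrArg g (hmap x)] at this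

theorem differentiableOn_tsum_mul_pow {a : ℕ → ℂ} {C q R : ℝ} (hq : 0 < q)
    (hqR : q * R < 1) (ha : ∀ k, ‖a k‖ ≤ C * q ^ k) (e : ℕ) :
    DifferentiableOn ℂ (fun z => ∑' k, a k * z ^ (k + e)) (Metric.ball 0 R) := by
  rcases le_or_gt R 0 with hR | hR
  · rw [Metric.ball_eq_empty.2 hR]; exact differentiableOn_empty
  refine Complex.differentiableOn_tsum_of_summable_norm (u := fun k => C * R ^ e * (q * R) ^ k)
    ((summable_geometric_of_lt_one (by positivity) hqR).mul_left _) (fun k => ?_)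
    Metric.isOpen_ball fun k z hz => ?_
  · exact ((differentiable_id.pow _).const_mul _).differentiableOn
  · rw [mem_ball_zero_iff] at hz
    have hC := (norm_nonneg _).trans (ha k)
    rw [norm_mul, norm_pow]
    refine (mul_le_mul (ha k) (pow_le_pow_left₀ (norm_nonneg z) hz.le _) (by positivity)
      hC).trans_eq ?_
    rw [pow_add, mul_pow]
    ring

/-- The Wiener–Hopf factorization of `f = exp g`, together with the identification of `alpha`. -/
theorem exists_isWienerHopf {f g : ℂ → ℂ} {U : Set ℂ} (hU : IsOpen U)
    (hUc : Metric.sphere (0 : ℂ) 1 ⊆ U) (hg : DifferentiableOn ℂ g U)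
    (hfg : ∀ z ∈ U, Complex.exp (g z) = f z) :
    ∃ (R : ℝ) (φ ψ : ℂ → ℂ), IsWienerHopf R φ ψ f ∧
      (∀ z, ‖z‖ < 1 → alpha g z = (φ z)⁻¹) ∧ ∀ z, z ≠ 0 → ‖z‖ < 1 → alpha g z⁻¹ = ψ z := by
  obtain ⟨C₁, q₁, hq₁, hq₁', h₁⟩ := exists_norm_coeff_le_of_isOpen hU hUc hg
  obtain ⟨C₂, q₂, hq₂, hq₂', h₂⟩ := exists_norm_coeff_neg_le_of_isOpen hU hUc hg
  have h₂' : ∀ k : ℕ, ‖coeff g (-((k : ℤ) + 1))‖ ≤ C₂ * q₂ * q₂ ^ k := fun k => by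
    have := h₂ (k + 1)
    rw [pow_succ] at this
    push_cast at this
    linarith
  have hs : Summable fun k : ℤ => coeff g k := by
    refine Summable.of_nat_of_neg_add_one ?_ ?_
    · exact Summable.of_norm_bounded
        ((summable_geometric_of_lt_one hq₁.le hq₁').mul_left C₁) h₁
    · exact Summable.of_norm_bounded
        ((summable_geometric_of_lt_one hq₂.le hq₂').mul_left (C₂ * q₂)) h₂'
  -- Both half-series converge up to radius 1/max(q₁, q₂) > 1.
  obtain ⟨R, hR1, hR⟩ : ∃ R : ℝ, 1 < R ∧ R < (max q₁ q₂)⁻¹ :=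
    exists_between ((one_lt_inv₀ (lt_max_of_lt_left hq₁)).2 (max_lt hq₁' hq₂'))
  have hqR : max q₁ q₂ * R < 1 := by
    have hm : 0 < max q₁ q₂ := lt_max_of_lt_left hq₁
    exact (mul_lt_mul_of_pos_left hR hm).trans_eq (mul_inv_cancel₀ hm.ne')
  have hq₁R : q₁ * R < 1 := lt_of_le_of_lt (by gcongr; exact le_max_left _ _) hqR
  have hq₂R : q₂ * R < 1 := lt_of_le_of_lt (by gcongr; exact le_max_right _ _) hqR
  refine ⟨R, fun z => Complex.exp (∑' k : ℕ, coeff g k * z ^ (k + 0)),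
    fun z => Complex.exp (∑' k : ℕ, coeff g (-((k : ℤ) + 1)) * z ^ (k + 1)), ?_, ?_, ?_⟩
  · refine ⟨hR1, (differentiableOn_tsum_mul_pow hq₁ hq₁R h₁ 0).cexp,
      (differentiableOn_tsum_mul_pow hq₂ hq₂R h₂' 1).cexp, fun _ _ => Complex.exp_ne_zero _,
      fun _ _ => Complex.exp_ne_zero _, fun z hz => ?_⟩
    have hsum := hasSum_coeff_mul_zpow (hg.continuousOn.mono hUc) hs hz
    have hz1 : ‖z‖ = 1 := mem_sphere_zero_iff_norm.1 hz
    rw [← hfg z (hUc hz), ← hsum.tsum_eq, ← Complex.exp_add, tsum_of_nat_of_neg_add_one]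
    · have : ∀ k : ℕ, z ^ (-((k : ℤ) + 1)) = z⁻¹ ^ (k + 1) := fun k => by
        rw [← inv_zpow']; exact_mod_cast rfl
      simp only [zpow_natCast, add_zero, this]
    · exact hsum.summable.comp_injective Nat.cast_injective
    · exact hsum.summable.comp_injective (i := fun k : ℕ => -((k : ℤ) + 1)) fun a b hab => by
        simpa using hab
  · intro z hz
    simp only [alpha, if_pos hz, Complex.exp_neg, add_zero]
  · intro z hz0 hz
    have h1 : ¬ ‖z⁻¹‖ < 1 := by
      rw [norm_inv, not_lt]
      exact (one_le_inv₀ (norm_pos_iff.2 hz0)).2 hz.le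
    have : ∀ k : ℕ, z⁻¹ ^ (-((k : ℤ) + 1)) = z ^ (k + 1) := fun k => by
      rw [inv_zpow', neg_neg]; exact_mod_cast rfl
    simp only [alpha, if_neg h1, this]

end LacunaryToeplitz

/-! ### Conclusion -/

theorem mainTheorem1
    (f g : ℂ → ℂ) (U : Set ℂ) (hU : IsOpen U) (hUc : Metric.sphere (0 : ℂ) 1 ⊆ U)
    (hf0 : ∀ z ∈ Metric.sphere (0 : ℂ) 1, f z ≠ 0)
    (hf : DifferentiableOn ℂ f U) (hg : DifferentiableOn ℂ g U)
    (hfg : ∀ z ∈ U, Complex.exp (g z) = f z)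
    (n : ℕ) (ηz ηs : ℝ) (hηs : 0 < ηs) (hηsz : ηs < ηz) (hηz : ηz < 1) :
    (∃ ρ : ℕ → ℝ, LacunaryToeplitz.RapidlyDecaying ρ ∧
      ∀ᶠ N : ℕ in Filter.atTop, ∀ h p : Fin n → ℤ, LacunaryToeplitz.Admissible N h p →
        ∃ r : ℂ, ‖r‖ ≤ ρ N ∧
          (LacunaryToeplitz.lacunaryToeplitz f N h p).det =
            (LacunaryToeplitz.toeplitz f N).det *
              ((LacunaryToeplitz.M g ηz ηs N h p).det + r)) ∧
    (∀ c : ℝ, 0 < c → ∀ L : ℕ, ∃ ρ : ℕ → ℝ, LacunaryToeplitz.RapidlyDecaying ρ ∧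
      ∀ᶠ N : ℕ in Filter.atTop, ∀ h p : Fin n → ℤ, LacunaryToeplitz.Admissible N h p →
        c * ((N : ℝ) ^ L)⁻¹ ≤ ‖(LacunaryToeplitz.M g ηz ηs N h p).det‖ →
        ∃ ε : ℂ, ‖ε‖ ≤ ρ N ∧
          (LacunaryToeplitz.lacunaryToeplitz f N h p).det =
            (LacunaryToeplitz.toeplitz f N).det *
              (LacunaryToeplitz.M g ηz ηs N h p).det * (1 + ε)) := by
  obtain ⟨R, φ, ψ, w, hin, hout⟩ := LacunaryToeplitz.exists_isWienerHopf hU hUc hg hfg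
  obtain ⟨C, q, hC, hq0, hq1, H⟩ := w.exists_det_lacunaryToeplitz hin hout hηs hηsz hηz n
  -- In (ii) the relative error is r / det M, so the lower bound c N^{-L} turns C N q^N into (C/c)
  -- N^{L+1} q^N.
  refine ⟨⟨_, LacunaryToeplitz.rapidlyDecaying_mul_pow_mul_pow hq0 hq1 C 1, H⟩,
    fun c hc L => ⟨_, LacunaryToeplitz.rapidlyDecaying_mul_pow_mul_pow hq0 hq1 (C / c) (L + 1), ?_⟩⟩
  filter_upwards [H, Filter.eventually_gt_atTop 0] with N hN hN0 h p hhp hdet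
  obtain ⟨r, hr, e⟩ := hN h p hhp
  have hN0' : (0 : ℝ) < N := by exact_mod_cast hN0
  have hlow : 0 < c * ((N : ℝ) ^ L)⁻¹ := by positivity
  have hne : (LacunaryToeplitz.M g ηz ηs N h p).det ≠ 0 := norm_pos_iff.1 (hlow.trans_le hdet)
  refine ⟨r / (LacunaryToeplitz.M g ηz ηs N h p).det, ?_, ?_⟩
  · rw [norm_div]
    refine (div_le_div₀ (by positivity) hr hlow hdet).trans_eq ?_
    rw [pow_one, pow_succ]
    field_simp
  · rw [e]
    field_simp
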